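/- Let $k$ be a field and let $H$ be a finite-dimensional weak Hopf algebra over $k$ which is semisimple as a ring. (A weak Hopf algebra is an algebra and coalgebra with $\Delta(gh)=\Delta(g)\Delta(h)$, $(\mathrm{id}\otimes\Delta)\Delta(1)=(\Delta(1)\otimes 1)(1\otimes\Delta(1))=(1\otimes\Delta(1))(\Delta(1)\otimes 1)$ and $\varepsilon(ghl)=\varepsilon(gh_1)\varepsilon(h_2l)=\varepsilon(gh_2)\varepsilon(h_1l)$, together with a linear antipode $S$ satisfying $S*\mathrm{id}=\varepsilon_s$, $\mathrm{id}*S=\varepsilon_t$ and $S*\mathrm{id}*S=S$, where $\varepsilon_t(h)=\varepsilon(1_1h)1_2$, $\varepsilon_s(h)=1_1\varepsilon(h1_2)$ and $H_t=\varepsilon_t(H)$.) Let $A$ be a right weak $H$-comodule algebra, that is, a $k$-algebra with a right $H$-comodule structure $\rho:A\to A\otimes H$, $a\mapsto a_0\otimes a_1$, such that $\rho(ab)=\rho(a)\rho(b)$ for all $a,b\in A$ and $\rho(1)\in A\otimes H_t$. Let $B=\{a\in A\mid \rho(a)=1_0a\otimes 1_1\}$ be its subalgebra of coinvariants, and suppose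 that * $B$ is finite-dimensional over $k$; * $A$ is faithfully flat as a right $B$-module; * $A/B$ is right weak $H$-Galois, i.e. the map $\beta:A\otimes_BA\to(A\otimes H)\rho(1)$, $a\otimes_Bb\mapsto ab_0\otimes b_1$, is bijective. For a ring $R$ put $\operatorname{fin.dim}R=\sup\{\operatorname{pd}_RM\mid M\text{ a finitely generated left }R\text{-module},\ \operatorname{pd}_RM<\infty\}$. If the finitistic dimension conjecture holds over $k$, i.e. $\operatorname{fin.dim}R<\infty$ for every finite-dimensional $k$-algebra $R$, then $$\operatorname{fin.dim}B=\operatorname{fin.dim}A.$$ -/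

import Mathlib

universe u v w w₁ w₂

open scoped TensorProduct

noncomputable section

namespace WeakHopf

open Coalgebra TensorProduct

/-! ### Weak bialgebras and weak Hopf algebras -/

/-- A weak bialgebra over a field `k`: an algebra and a coalgebra with multiplicative
comultiplication and weakened unit and counit axioms. -/
class WeakBialgebra (k : Type u) (H : Type w) [Field k] [Ring H] [Algebra k H] extends
    Coalgebra k H where
  /-- `Δ(gh) = Δ(g)Δ(h)` -/
  comul_mul (g h : H) : comul (g * h) = comul g * comul h
  /-- `Δ²(1) = 1₁ ⊗ 1₂1'₁ ⊗ 1'₂ = (Δ(1) ⊗ 1)(1 ⊗ Δ(1))` -/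
  comul_comul_one : comul.lTensor H (comul 1) =
    TensorProduct.assoc k H H H (comul 1 ⊗ₜ[k] (1 : H)) * ((1 : H) ⊗ₜ[k] comul (1 : H))
  /-- `Δ²(1) = 1₁ ⊗ 1'₁1₂ ⊗ 1'₂ = (1 ⊗ Δ(1))(Δ(1) ⊗ 1)` -/
  comul_comul_one' : comul.lTensor H (comul 1) =
    ((1 : H) ⊗ₜ[k] comul (1 : H)) * TensorProduct.assoc k H H H (comul 1 ⊗ₜ[k] (1 : H))
  /-- `ε(ghl) = ε(gh₁)ε(h₂l)` -/
  counit_mul_mul (g h l : H) : counit (g * h * l) =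
    LinearMap.mul' k k (TensorProduct.map (counit ∘ₗ LinearMap.mulLeft k g)
      (counit ∘ₗ LinearMap.mulRight k l) (comul h))
  /-- `ε(ghl) = ε(gh₂)ε(h₁l)` -/
  counit_mul_mul' (g h l : H) : counit (g * h * l) =
    LinearMap.mul' k k (TensorProduct.map (counit ∘ₗ LinearMap.mulRight k l)
      (counit ∘ₗ LinearMap.mulLeft k g) (comul h))

section Maps

variable (k : Type u) (H : Type w) [Field k] [Ring H] [Algebra k H] [Coalgebra k H]

/-- The target map `ε_t(h) = ε(1₁h)1₂`, obtained from `Δ(1)(h ⊗ 1)` by applying `ε ⊗ id`. -/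
def targetMap : H →ₗ[k] H :=
  (TensorProduct.lid k H).toLinearMap ∘ₗ counit.rTensor H ∘ₗ
    LinearMap.mulLeft k (comul (R := k) (1 : H)) ∘ₗ (TensorProduct.mk k H H).flip 1

/-- The source map `ε_s(h) = 1₁ε(h1₂)`, obtained from `(1 ⊗ h)Δ(1)` by applying `id ⊗ ε`. -/
def sourceMap : H →ₗ[k] H :=
  (TensorProduct.rid k H).toLinearMap ∘ₗ counit.lTensor H ∘ₗ
    LinearMap.mulRight k (comul (R := k) (1 : H)) ∘ₗ TensorProduct.mk k H H 1

/-- The target space `H_t = ε_t(H)`. -/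
def targetSpace : Submodule k H := LinearMap.range (targetMap k H)

variable {k H} in
/-- The convolution product `(f * g)(h) = f(h₁)g(h₂)`. -/
def conv (f g : H →ₗ[k] H) : H →ₗ[k] H :=
  LinearMap.mul' k H ∘ₗ TensorProduct.map f g ∘ₗ comul

end Maps

/-- A weak Hopf algebra: a weak bialgebra with an antipode. -/
class WeakHopfAlgebra (k : Type u) (H : Type w) [Field k] [Ring H] [Algebra k H] extends
    WeakBialgebra k H where
  /-- The antipode. -/
  antipode : H →ₗ[k] H
  /-- `S * id = ε_s` -/
  conv_antipode_id : conv antipode LinearMap.id = sourceMap k H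
  /-- `id * S = ε_t` -/
  conv_id_antipode : conv LinearMap.id antipode = targetMap k H
  /-- `S * id * S = S` -/
  conv_antipode_id_antipode : conv (conv antipode LinearMap.id) antipode = antipode

/-! ### Weak comodule algebras and coinvariants -/

/-- A right weak `H`-comodule algebra `A`. -/
class WeakComoduleAlgebra (k : Type u) (H : Type w) (A : Type v) [Field k] [Ring H] [Algebra k H]
    [WeakHopfAlgebra k H] [Ring A] [Algebra k A] where
  /-- The coaction `ρ(a) = a₀ ⊗ a₁`. -/
  coaction : A →ₗ[k] A ⊗[k] H
  coassoc (a : A) : TensorProduct.assoc k A H H (coaction.rTensor H (coaction a)) =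
    (comul (R := k) (A := H)).lTensor A (coaction a)
  counit_coaction (a : A) :
    TensorProduct.rid k A ((counit (R := k) (A := H)).lTensor A (coaction a)) = a
  coaction_mul (a b : A) : coaction (a * b) = coaction a * coaction b
  /-- `1₀ ⊗ 1₁ ∈ A ⊗ H_t` -/
  coaction_one_mem : coaction 1 ∈ LinearMap.range ((targetSpace k H).subtype.lTensor A)

section Coinvariants

variable (k : Type u) (H : Type w) (A : Type v) [Field k] [Ring H] [Algebra k H]
  [WeakHopfAlgebra k H] [Ring A] [Algebra k A] [WeakComoduleAlgebra k H A]

/-- The coaction `ρ : A → A ⊗ H`. -/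
abbrev rho : A →ₗ[k] A ⊗[k] H := WeakComoduleAlgebra.coaction

/-- The coinvariants `B = {a ∈ A | ρ(a) = 1₀a ⊗ 1₁}`. -/
def coinvariants : Subalgebra k A where
  carrier := {a | rho k H A a = rho k H A 1 * (a ⊗ₜ[k] (1 : H))}
  mul_mem' {a b} ha hb := by
    simp only [Set.mem_ofPred_eq] at ha hb ⊢
    have h1 : rho k H A a * rho k H A 1 = rho k H A a := by
      rw [← WeakComoduleAlgebra.coaction_mul, mul_one]
    rw [WeakComoduleAlgebra.coaction_mul, hb, ← mul_assoc, h1, ha, mul_assoc,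
      Algebra.TensorProduct.tmul_mul_tmul, one_mul]
  add_mem' {a b} ha hb := by
    simp only [Set.mem_ofPred_eq] at ha hb ⊢
    rw [map_add, ha, hb, add_tmul, mul_add]
  algebraMap_mem' r := by
    simp only [Set.mem_ofPred_eq, Algebra.algebraMap_eq_smul_one, map_smul]
    rw [← smul_tmul', ← Algebra.TensorProduct.one_def, mul_smul_comm, mul_one]

end Coinvariants

/-! ### The tensor product `A ⊗_B M` over a subalgebra `B`, and faithful flatness -/

section Balanced

variable {k : Type u} {A : Type v} [Field k] [Ring A] [Algebra k A] (B : Subalgebra k A)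

section Defs
variable (M : Type w₁) [AddCommGroup M] [Module B M]

/-- The subgroup of `A ⊗_ℤ M` generated by the elements `ab ⊗ m - a ⊗ bm` with `b ∈ B`. -/
def balancedRel : AddSubgroup (A ⊗[ℤ] M) :=
  AddSubgroup.closure {x | ∃ (a : A) (b : B) (m : M),
    x = (a * (b : A)) ⊗ₜ[ℤ] m - a ⊗ₜ[ℤ] (b • m)}

/-- The tensor product `A ⊗_B M` of the right `B`-module `A` and a left `B`-module `M`. -/
abbrev BalancedTensor : Type (max v w₁) := (A ⊗[ℤ] M) ⧸ balancedRel B M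

end Defs

variable {M : Type w₁} [AddCommGroup M] [Module B M] {N : Type w₂} [AddCommGroup N] [Module B N]

/-- The map `A ⊗_B f : A ⊗_B M → A ⊗_B N`. -/
def balancedMap (f : M →ₗ[B] N) : BalancedTensor B M →+ BalancedTensor B N :=
  QuotientAddGroup.map _ _ (f.toAddMonoidHom.toIntLinearMap.lTensor A).toAddMonoidHom <| by
    refine (AddSubgroup.closure_le _).2 ?_
    rintro _ ⟨a, b, m, rfl⟩
    refine AddSubgroup.subset_closure ⟨a, b, f m, ?_⟩
    rw [map_sub]
    exact congrArg (fun y => (a * (b : A)) ⊗ₜ[ℤ] f m - a ⊗ₜ[ℤ] y) (f.map_smul b m)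

/-- `A` is faithfully flat as a right `B`-module: a sequence of left `B`-modules is exact
if and only if it is exact after applying `A ⊗_B -`. -/
def IsRightFaithfullyFlat : Prop :=
  ∀ (L M N : Type v) [AddCommGroup L] [AddCommGroup M] [AddCommGroup N]
    [Module B L] [Module B M] [Module B N] (f : L →ₗ[B] M) (g : M →ₗ[B] N),
    Function.Exact f g ↔ Function.Exact (balancedMap B f) (balancedMap B g)

end Balanced

/-! ### The Galois map -/

lemma biadditive_zsmul {X Y Z : Type*} [AddCommGroup X] [AddCommGroup Y] [AddCommGroup Z]
    (f : X →+ Y →+ Z) (n : ℤ) (x : X) (y : Y) : f (n • x) y = f x (n • y) := by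
  rw [map_zsmul, map_zsmul, AddMonoidHom.coe_smul, Pi.smul_apply]

lemma assoc_mul {k : Type u} {H : Type w} {A : Type v} [Field k] [Ring H] [Algebra k H]
    [Ring A] [Algebra k A] (x y : (A ⊗[k] H) ⊗[k] H) :
    TensorProduct.assoc k A H H (x * y) =
      TensorProduct.assoc k A H H x * TensorProduct.assoc k A H H y :=
  map_mul (Algebra.TensorProduct.assoc k k k A H H) x y

section Galois

variable {k : Type u} {H : Type w} {A : Type v} [Field k] [Ring H] [Algebra k H]
  [WeakHopfAlgebra k H] [Ring A] [Algebra k A]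

/-- For `z ∈ H_t`: `Δ(z) = z1₁ ⊗ 1₂`. -/
lemma comul_of_mem_targetSpace {z : H} (hz : z ∈ targetSpace k H) :
    comul (R := k) z = (z ⊗ₜ[k] (1 : H)) * comul 1 := by
  obtain ⟨h, rfl⟩ := hz
  have e1 : ∀ x : H ⊗[k] H, comul (R := k) (TensorProduct.lid k H (counit.rTensor H x)) =
      TensorProduct.lid k (H ⊗[k] H) ((counit (R := k) (A := H)).rTensor (H ⊗[k] H)
        (comul.lTensor H x)) := by
    intro x
    induction x with
    | zero => simp
    | tmul x y => simp
    | add x y hx hy => simp only [map_add, hx, hy]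
  have e2 : ∀ x : H ⊗[k] H, (comul (R := k) (A := H)).lTensor H (x * (h ⊗ₜ[k] (1 : H))) =
      comul.lTensor H x * (h ⊗ₜ[k] (1 : H ⊗[k] H)) := by
    intro x
    induction x with
    | zero => simp
    | tmul x y => simp [Algebra.TensorProduct.tmul_mul_tmul]
    | add x y hx hy => simp only [map_add, add_mul, hx, hy]
  have e3 : ∀ (x : H ⊗[k] H) (c : H ⊗[k] H),
      TensorProduct.lid k (H ⊗[k] H) ((counit (R := k) (A := H)).rTensor (H ⊗[k] H)
        (TensorProduct.assoc k H H H (x ⊗ₜ[k] (1 : H)) * ((1 : H) ⊗ₜ[k] c) *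
          (h ⊗ₜ[k] (1 : H ⊗[k] H)))) =
      (TensorProduct.lid k H (counit.rTensor H (x * (h ⊗ₜ[k] (1 : H)))) ⊗ₜ[k] (1 : H)) * c := by
    intro x c
    induction x with
    | zero => simp
    | tmul x y => simp only [TensorProduct.assoc_tmul, Algebra.TensorProduct.tmul_mul_tmul, mul_one,
        LinearMap.rTensor_tmul, TensorProduct.lid_tmul, ← TensorProduct.smul_tmul',
        smul_mul_assoc]
    | add x y hx hy => simp only [map_add, add_tmul, add_mul, hx, hy]
  change comul (R := k) (TensorProduct.lid k H (counit.rTensor H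
    (comul 1 * (h ⊗ₜ[k] (1 : H))))) = (TensorProduct.lid k H (counit.rTensor H
    (comul 1 * (h ⊗ₜ[k] (1 : H)))) ⊗ₜ[k] (1 : H)) * comul 1
  rw [e1, e2, WeakBialgebra.comul_comul_one, e3]

/-- For `x ∈ A ⊗ H_t`: `(id ⊗ Δ)(x) = (x ⊗ 1)(1 ⊗ Δ(1))`. -/
lemma lTensor_comul_of_mem {x : A ⊗[k] H}
    (hx : x ∈ LinearMap.range ((targetSpace k H).subtype.lTensor A)) :
    (comul (R := k) (A := H)).lTensor A x =
      TensorProduct.assoc k A H H (x ⊗ₜ[k] (1 : H)) * ((1 : A) ⊗ₜ[k] comul (1 : H)) := by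
  obtain ⟨y, rfl⟩ := hx
  induction y with
  | zero => simp
  | tmul a z => simp [Algebra.TensorProduct.tmul_mul_tmul, comul_of_mem_targetSpace z.2]
  | add x y hx hy => simp only [map_add, add_tmul, add_mul, hx, hy]

variable [WeakComoduleAlgebra k H A]

/-- For a coinvariant `b`: `ρ(b) = b1₀ ⊗ 1₁`. -/
lemma rho_of_mem_coinvariants {b : A} (hb : b ∈ coinvariants k H A) :
    rho k H A b = (b ⊗ₜ[k] (1 : H)) * rho k H A 1 := by
  have hb' : rho k H A b = rho k H A 1 * (b ⊗ₜ[k] (1 : H)) := hb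
  have hmem : rho k H A b ∈ LinearMap.range ((targetSpace k H).subtype.lTensor A) := by
    rw [hb']
    obtain ⟨y, hy⟩ := WeakComoduleAlgebra.coaction_one_mem (k := k) (H := H) (A := A)
    rw [← hy]
    clear hy
    induction y with
    | zero => simp
    | tmul a z => exact ⟨(a * b) ⊗ₜ z, by simp [Algebra.TensorProduct.tmul_mul_tmul]⟩
    | add x y hx hy => rw [map_add, add_mul]; exact add_mem hx hy
  let F : A ⊗[k] (H ⊗[k] H) →ₗ[k] A ⊗[k] H :=
    ((TensorProduct.lid k H).toLinearMap ∘ₗ counit.rTensor H).lTensor A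
  have f1 : ∀ x : A ⊗[k] H, F ((comul (R := k) (A := H)).lTensor A x) = x := by
    intro x
    induction x with
    | zero => simp
    | tmul a h => simp [F]
    | add x y hx hy => simp only [map_add, hx, hy]
  have f2 : ∀ (z : A ⊗[k] H) (h : H), F (TensorProduct.assoc k A H H (z ⊗ₜ[k] h)) =
      (TensorProduct.rid k A ((counit (R := k) (A := H)).lTensor A z)) ⊗ₜ[k] h := by
    intro z h
    induction z with
    | zero => simp
    | tmul a g => simp [F, TensorProduct.smul_tmul]
    | add x y hx hy => simp only [map_add, add_tmul, hx, hy]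
  have f3 : ∀ x : A ⊗[k] H, F (TensorProduct.assoc k A H H ((rho k H A).rTensor H x)) = x := by
    intro x
    induction x with
    | zero => simp
    | tmul a h => rw [LinearMap.rTensor_tmul, f2, WeakComoduleAlgebra.counit_coaction]
    | add x y hx hy => simp only [map_add, hx, hy]
  have f4 : ∀ x : A ⊗[k] H, (rho k H A).rTensor H ((b ⊗ₜ[k] (1 : H)) * x) =
      (rho k H A b ⊗ₜ[k] (1 : H)) * (rho k H A).rTensor H x := by
    intro x
    induction x with
    | zero => simp
    | tmul a h =>
      simp [Algebra.TensorProduct.tmul_mul_tmul, WeakComoduleAlgebra.coaction_mul]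
    | add x y hx hy => simp only [map_add, mul_add, hx, hy]
  have h1 : rho k H A b * rho k H A 1 = rho k H A b := by
    rw [← WeakComoduleAlgebra.coaction_mul, mul_one]
  rw [← f3 ((b ⊗ₜ[k] (1 : H)) * rho k H A 1), f4, assoc_mul, WeakComoduleAlgebra.coassoc,
    lTensor_comul_of_mem WeakComoduleAlgebra.coaction_one_mem, ← mul_assoc, ← assoc_mul,
    Algebra.TensorProduct.tmul_mul_tmul, h1, mul_one, ← lTensor_comul_of_mem hmem, f1]

variable (k H A)

/-- The subspace `A ⊗_t H = (A ⊗ H)ρ(1)` of `A ⊗ H`. -/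
def tensorTarget : Submodule k (A ⊗[k] H) :=
  LinearMap.range (LinearMap.mulRight k (rho k H A 1))

/-- The biadditive map `(a, b) ↦ ab₀ ⊗ b₁ = (a ⊗ 1)ρ(b)` with values in `A ⊗_t H`. -/
def galoisPair : A →+ A →+ tensorTarget k H A :=
  AddMonoidHom.mk' (fun a => AddMonoidHom.mk'
    (fun b => (⟨(a ⊗ₜ[k] (1 : H)) * rho k H A b, (a ⊗ₜ[k] (1 : H)) * rho k H A b, by
      rw [LinearMap.mulRight_apply, mul_assoc, ← WeakComoduleAlgebra.coaction_mul,
        mul_one]⟩ : tensorTarget k H A))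
    (fun b b' => Subtype.ext (by simp [mul_add])))
    (fun a a' => AddMonoidHom.ext fun b => Subtype.ext (by simp [add_tmul, add_mul]))

/-- The map `A ⊗_ℤ A → A ⊗_t H`, `a ⊗ b ↦ ab₀ ⊗ b₁`. -/
def galoisAux : A ⊗[ℤ] A →+ tensorTarget k H A :=
  TensorProduct.liftAddHom (galoisPair k H A) (biadditive_zsmul (galoisPair k H A))

/-- The Galois map `β : A ⊗_B A → A ⊗_t H`, `a ⊗_B b ↦ ab₀ ⊗_t b₁`, where `B` is the algebra
of coinvariants of `A`. -/
def galoisMap : BalancedTensor (coinvariants k H A) A →+ tensorTarget k H A :=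
  QuotientAddGroup.lift (balancedRel (coinvariants k H A) A) (galoisAux k H A) <| by
    refine (AddSubgroup.closure_le _).2 ?_
    rintro _ ⟨a, b, m, rfl⟩
    rw [SetLike.mem_coe, AddMonoidHom.mem_ker, map_sub, sub_eq_zero]
    refine Subtype.ext ?_
    change ((a * (b : A)) ⊗ₜ[k] (1 : H)) * rho k H A m =
      (a ⊗ₜ[k] (1 : H)) * rho k H A ((b : A) * m)
    rw [WeakComoduleAlgebra.coaction_mul, rho_of_mem_coinvariants b.2, mul_assoc,
      ← WeakComoduleAlgebra.coaction_mul 1 m, one_mul, ← mul_assoc,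
      Algebra.TensorProduct.tmul_mul_tmul, one_mul]

/-- The extension `A/B`, with `B` the coinvariants of `A`, is right weak `H`-Galois. -/
def IsWeakGalois : Prop := Function.Bijective (galoisMap k H A)

end Galois

/-! ### Finitistic dimension -/

/-- The finitistic dimension of a ring `R`: the supremum of the projective dimensions of the
finitely generated left `R`-modules of finite projective dimension. The zero module has
projective dimension `⊥`. -/
def finDim (R : Type v) [Ring R] : WithBot ℕ∞ :=
  ⨆ (M : ModuleCat.{v} R) (_ : Module.Finite R M)
    (_ : CategoryTheory.projectiveDimension M < ⊤), CategoryTheory.projectiveDimension M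

/-- The finitistic dimension conjecture over the field `k`: every finite-dimensional
`k`-algebra has finite finitistic dimension. -/
def FinitisticDimensionConjecture (k : Type u) [Field k] : Prop :=
  ∀ (R : Type v) [Ring R] [Algebra k R], FiniteDimensional k R → finDim R < ⊤

end WeakHopf

end

/-!
Since `H` is semisimple, it has a normalized integral `t`, that is, `t h = t ε_s(h)` and
`ε_s(t) = 1`. The preimage of `(1 ⊗ t) ρ(1)` under the Galois map is a separability element of
`A/B`, so every `A`-module `N` is a direct summand of `A ⊗_B N`. Traces of twisted multiplication
operators on `H` are integrals of the dual, and through the Galois map they give a finite dual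
basis of `A` as a left `B`-module. Hence `A` is finitely generated projective over `B` on the left;
as it is flat on the right, `pd_A N = pd_B N` for every `A`-module `N`, and
`fin.dim A ≤ fin.dim B`.

Conversely, suppose `fin.dim A < n = fin.dim B < ∞` and let `M` be finitely generated with
`pd_B M = n`. By faithful flatness `0 → M → A ⊗_B M → C → 0` is exact, where
`pd_B (A ⊗_B M) ≤ fin.dim A < n` and `pd_B C ≤ n`. This forces `pd_B M < n`, a contradiction.
-/

noncomputable section

namespace WeakHopf

open Coalgebra TensorProduct WithConv

section GeneralizedInverse

variable {S : Type*} [Semigroup S]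

lemma generalizedInverse_unique {a b m : S} (hleft : a * m = b * m) (hright : m * a = m * b)
    (ha : a * m * a = a) (hb : b * m * b = b) : a = b := by
  rw [← ha, hleft, mul_assoc, hright, ← mul_assoc, hb]

lemma mul_generalizedInverse {x x' y y' : S} (hcomm : Commute (x' * x) (y * y'))
    (hx : x' * x * x' = x') (hy : y' * y * y' = y') :
    y' * x' * (x * y) * (y' * x') = y' * x' :=
  calc y' * x' * (x * y) * (y' * x') = y' * ((x' * x) * (y * y')) * x' := by simp only [mul_assoc]
    _ = (y' * y * y') * (x' * x * x') := by rw [hcomm.eq]; simp only [mul_assoc]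
    _ = y' * x' := by rw [hx, hy]

end GeneralizedInverse

/-! ### Slice maps -/

section Slice

section Module

variable {R M N P : Type*} [CommSemiring R] [AddCommMonoid M] [AddCommMonoid N] [AddCommMonoid P]
  [Module R M] [Module R N] [Module R P]

/-- The slice map `id ⊗ χ : M ⊗ N → M` along a functional `χ` on the right factor. -/
def sliceRight (χ : N →ₗ[R] R) : M ⊗[R] N →ₗ[R] M :=
  (TensorProduct.rid R M).toLinearMap ∘ₗ χ.lTensor M

/-- The slice map `χ ⊗ id : M ⊗ N → N` along a functional `χ` on the left factor. -/
def sliceLeft (χ : M →ₗ[R] R) : M ⊗[R] N →ₗ[R] N :=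
  (TensorProduct.lid R N).toLinearMap ∘ₗ χ.rTensor N

@[simp] lemma sliceRight_tmul (χ : N →ₗ[R] R) (x : M) (y : N) :
    sliceRight χ (x ⊗ₜ[R] y) = χ y • x := by
  simp [sliceRight]

@[simp] lemma sliceLeft_tmul (χ : M →ₗ[R] R) (x : M) (y : N) :
    sliceLeft χ (x ⊗ₜ[R] y) = χ x • y := by
  simp [sliceLeft]

lemma map_sliceRight (f : M →ₗ[R] P) (χ : N →ₗ[R] R) (u : M ⊗[R] N) :
    f (sliceRight χ u) = sliceRight χ (f.rTensor N u) := by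
  induction u with
  | zero => simp
  | tmul x y => simp
  | add u v hu hv => simp only [map_add, hu, hv]

lemma map_sliceLeft (f : N →ₗ[R] P) (χ : M →ₗ[R] R) (u : M ⊗[R] N) :
    f (sliceLeft χ u) = sliceLeft χ (f.lTensor M u) := by
  induction u with
  | zero => simp
  | tmul x y => simp
  | add u v hu hv => simp only [map_add, hu, hv]

lemma apply_sliceRight (χ : M →ₗ[R] R) (ψ : N →ₗ[R] R) (u : M ⊗[R] N) :
    χ (sliceRight ψ u) = LinearMap.mul' R R (TensorProduct.map χ ψ u) := by
  induction u with
  | zero => simp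
  | tmul x y => simp [mul_comm]
  | add u v hu hv => simp only [map_add, hu, hv]

lemma apply_sliceLeft (χ : M →ₗ[R] R) (ψ : N →ₗ[R] R) (u : M ⊗[R] N) :
    ψ (sliceLeft χ u) = LinearMap.mul' R R (TensorProduct.map χ ψ u) := by
  induction u with
  | zero => simp
  | tmul x y => simp
  | add u v hu hv => simp only [map_add, hu, hv]

lemma sliceRight_lTensor (χ : P →ₗ[R] R) (f : N →ₗ[R] P) (u : M ⊗[R] N) :
    sliceRight χ (f.lTensor M u) = sliceRight (χ ∘ₗ f) u := by
  induction u with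
  | zero => simp
  | tmul x y => simp
  | add u v hu hv => simp only [map_add, hu, hv]

lemma sliceRight_eq_lTensor_assoc (χ : P →ₗ[R] R) (u : (M ⊗[R] N) ⊗[R] P) :
    sliceRight χ u = (sliceRight χ).lTensor M (TensorProduct.assoc R M N P u) := by
  have hcomp : sliceRight χ =
      (sliceRight χ).lTensor M ∘ₗ (TensorProduct.assoc R M N P).toLinearMap := by
    ext x y z
    simp
  exact LinearMap.congr_fun hcomp u

end Module

section Algebra

variable {R A B C : Type*} [CommSemiring R] [Semiring A] [Semiring B] [Semiring C]
  [Algebra R A] [Algebra R B] [Algebra R C]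

lemma sliceRight_tmul_one_mul (χ : B →ₗ[R] R) (a : A) (u : A ⊗[R] B) :
    sliceRight χ ((a ⊗ₜ[R] (1 : B)) * u) = a * sliceRight χ u := by
  induction u with
  | zero => simp
  | tmul x y => simp
  | add u v hu hv => simp only [mul_add, map_add, hu, hv]

lemma sliceRight_one_tmul_mul (χ : B →ₗ[R] R) (b : B) (u : A ⊗[R] B) :
    sliceRight χ (((1 : A) ⊗ₜ[R] b) * u) = sliceRight (χ ∘ₗ LinearMap.mulLeft R b) u := by
  induction u with
  | zero => simp
  | tmul x y => simp
  | add u v hu hv => simp only [mul_add, map_add, hu, hv]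

lemma sliceRight_mul_tmul_one (χ : B →ₗ[R] R) (a : A) (u : A ⊗[R] B) :
    sliceRight χ (u * (a ⊗ₜ[R] (1 : B))) = sliceRight χ u * a := by
  induction u with
  | zero => simp
  | tmul x y => simp
  | add u v hu hv => simp only [add_mul, map_add, hu, hv]

lemma sliceRight_mul_one_tmul (χ : B →ₗ[R] R) (b : B) (u : A ⊗[R] B) :
    sliceRight χ (u * ((1 : A) ⊗ₜ[R] b)) = sliceRight (χ ∘ₗ LinearMap.mulRight R b) u := by
  induction u with
  | zero => simp
  | tmul x y => simp
  | add u v hu hv => simp only [add_mul, map_add, hu, hv]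

lemma sliceLeft_mul_tmul_one (χ : A →ₗ[R] R) (a : A) (u : A ⊗[R] B) :
    sliceLeft χ (u * (a ⊗ₜ[R] (1 : B))) = sliceLeft (χ ∘ₗ LinearMap.mulRight R a) u := by
  induction u with
  | zero => simp
  | tmul x y => simp
  | add u v hu hv => simp only [add_mul, map_add, hu, hv]

lemma sliceLeft_one_tmul_mul (χ : A →ₗ[R] R) (b : B) (u : A ⊗[R] B) :
    sliceLeft χ (((1 : A) ⊗ₜ[R] b) * u) = b * sliceLeft χ u := by
  induction u with
  | zero => simp
  | tmul x y => simp
  | add u v hu hv => simp only [mul_add, map_add, hu, hv]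

lemma sliceLeft_mul_one_tmul (χ : A →ₗ[R] R) (b : B) (u : A ⊗[R] B) :
    sliceLeft χ (u * ((1 : A) ⊗ₜ[R] b)) = sliceLeft χ u * b := by
  induction u with
  | zero => simp
  | tmul x y => simp
  | add u v hu hv => simp only [add_mul, map_add, hu, hv]

lemma sliceLeft_one_tmul_mul_assoc (χ : A →ₗ[R] R) (v : B ⊗[R] C) (u : A ⊗[R] B) (c : C) :
    sliceLeft χ (((1 : A) ⊗ₜ[R] v) * TensorProduct.assoc R A B C (u ⊗ₜ[R] c)) =
      v * (sliceLeft χ u ⊗ₜ[R] c) := by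
  induction u with
  | zero => simp
  | tmul x y => simp [← smul_tmul']
  | add u u' hu hu' => simp only [add_tmul, mul_add, map_add, hu, hu']

lemma sliceRight_tmul_one_mul_assoc_symm (χ : C →ₗ[R] R) (v : A ⊗[R] B) (a : A) (u : B ⊗[R] C) :
    sliceRight χ ((v ⊗ₜ[R] (1 : C)) * (TensorProduct.assoc R A B C).symm (a ⊗ₜ[R] u)) =
      v * (a ⊗ₜ[R] sliceRight χ u) := by
  induction u with
  | zero => simp
  | tmul x y => simp
  | add u u' hu hu' => simp only [tmul_add, mul_add, map_add, hu, hu']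

lemma sliceRight_assoc_symm_mul_tmul_one (χ : C →ₗ[R] R) (v : A ⊗[R] B) (a : A) (u : B ⊗[R] C) :
    sliceRight χ ((TensorProduct.assoc R A B C).symm (a ⊗ₜ[R] u) * (v ⊗ₜ[R] (1 : C))) =
      (a ⊗ₜ[R] sliceRight χ u) * v := by
  induction u with
  | zero => simp
  | tmul x y => simp
  | add u u' hu hu' => simp only [tmul_add, add_mul, map_add, hu, hu']

end Algebra

end Slice

/-! ### Weak bialgebras -/

section CounitalMaps

variable {k : Type u} {H : Type w} [Field k] [Ring H] [Algebra k H] [Coalgebra k H]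

lemma targetMap_eq_sliceLeft (h : H) :
    targetMap k H h = sliceLeft (counit ∘ₗ LinearMap.mulRight k h) (comul (R := k) (1 : H)) :=
  sliceLeft_mul_tmul_one counit h _

lemma sourceMap_eq_sliceRight (h : H) :
    sourceMap k H h = sliceRight (counit ∘ₗ LinearMap.mulLeft k h) (comul (R := k) (1 : H)) :=
  sliceRight_one_tmul_mul counit h _

variable (k H) in
/-- The map `h ↦ ε(h1₁)1₂`, which is the target map of `H` with the opposite multiplication. -/
def targetMapOp : H →ₗ[k] H :=
  sliceLeft counit ∘ₗ LinearMap.mulRight k (comul (R := k) (1 : H)) ∘ₗ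
    (TensorProduct.mk k H H).flip 1

lemma targetMapOp_eq_sliceLeft (h : H) :
    targetMapOp k H h = sliceLeft (counit ∘ₗ LinearMap.mulLeft k h) (comul (R := k) (1 : H)) := by
  change sliceLeft counit ((h ⊗ₜ[k] (1 : H)) * comul (R := k) (1 : H)) = _
  generalize comul (R := k) (1 : H) = u
  induction u with
  | zero => simp
  | tmul x y => simp
  | add u v hu hv => simp only [mul_add, map_add, hu, hv]

@[simp] lemma sourceMap_one : sourceMap k H 1 = 1 := by
  simp [sourceMap_eq_sliceRight, sliceRight]

end CounitalMaps

section WeakBialgebra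

variable {k : Type u} {H : Type w} [Field k] [Ring H] [Algebra k H] [WeakBialgebra k H]

lemma counit_mul_targetMap (g h : H) :
    counit (R := k) (g * targetMap k H h) = counit (R := k) (g * h) := by
  have key := WeakBialgebra.counit_mul_mul' (k := k) g 1 h
  rw [mul_one, ← apply_sliceLeft, ← targetMap_eq_sliceLeft] at key
  exact key.symm

lemma counit_sourceMap_mul (g h : H) :
    counit (R := k) (sourceMap k H g * h) = counit (R := k) (g * h) := by
  have key := WeakBialgebra.counit_mul_mul' (k := k) g 1 h
  rw [mul_one, ← apply_sliceRight, ← sourceMap_eq_sliceRight] at key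
  exact key.symm

lemma counit_targetMapOp_mul (g h : H) :
    counit (R := k) (targetMapOp k H g * h) = counit (R := k) (g * h) := by
  have key := WeakBialgebra.counit_mul_mul (k := k) g 1 h
  rw [mul_one, ← apply_sliceLeft, ← targetMapOp_eq_sliceLeft] at key
  exact key.symm

lemma targetMap_mul_targetMap (g h : H) :
    targetMap k H (g * targetMap k H h) = targetMap k H (g * h) := by
  have hχ : counit ∘ₗ LinearMap.mulRight k (g * targetMap k H h) =
      counit ∘ₗ LinearMap.mulRight k (g * h) := by
    ext x
    simp [counit_mul_targetMap]
  simp only [targetMap_eq_sliceLeft (g * _), hχ]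

lemma sourceMap_sourceMap_mul (g h : H) :
    sourceMap k H (sourceMap k H g * h) = sourceMap k H (g * h) := by
  have hχ : counit ∘ₗ LinearMap.mulLeft k (sourceMap k H g * h) =
      counit ∘ₗ LinearMap.mulLeft k (g * h) := by
    ext x
    simp [counit_sourceMap_mul]
  simp only [sourceMap_eq_sliceRight (_ * h), hχ]

lemma sourceMap_targetMapOp (h : H) : sourceMap k H (targetMapOp k H h) = sourceMap k H h := by
  have hχ : counit ∘ₗ LinearMap.mulLeft k (targetMapOp k H h) =
      counit ∘ₗ LinearMap.mulLeft k h := by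
    ext x
    simp [counit_targetMapOp_mul]
  simp only [sourceMap_eq_sliceRight, hχ]

lemma targetMap_targetMap (h : H) : targetMap k H (targetMap k H h) = targetMap k H h := by
  simpa using targetMap_mul_targetMap (k := k) 1 h

lemma sourceMap_sourceMap (h : H) : sourceMap k H (sourceMap k H h) = sourceMap k H h := by
  simpa using sourceMap_sourceMap_mul (k := k) h 1

lemma targetMap_of_mem {z : H} (hz : z ∈ targetSpace k H) : targetMap k H z = z := by
  obtain ⟨h, rfl⟩ := hz
  exact targetMap_targetMap h

lemma comul_targetMap (h : H) : comul (R := k) (targetMap k H h) =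
    comul 1 * (targetMap k H h ⊗ₜ[k] (1 : H)) := by
  rw [targetMap_eq_sliceLeft, map_sliceLeft, WeakBialgebra.comul_comul_one',
    sliceLeft_one_tmul_mul_assoc]

variable (k H) in
lemma rTensor_comul_comul_one : comul.rTensor H (comul (R := k) (1 : H)) =
    (comul (R := k) (1 : H) ⊗ₜ[k] (1 : H)) *
      (TensorProduct.assoc k H H H).symm ((1 : H) ⊗ₜ[k] comul (R := k) (1 : H)) := by
  rw [← coassoc_symm_apply, WeakBialgebra.comul_comul_one, LinearEquiv.symm_apply_eq, assoc_mul,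
    LinearEquiv.apply_symm_apply]

variable (k H) in
lemma rTensor_comul_comul_one' : comul.rTensor H (comul (R := k) (1 : H)) =
    (TensorProduct.assoc k H H H).symm ((1 : H) ⊗ₜ[k] comul (R := k) (1 : H)) *
      (comul (R := k) (1 : H) ⊗ₜ[k] (1 : H)) := by
  rw [← coassoc_symm_apply, WeakBialgebra.comul_comul_one', LinearEquiv.symm_apply_eq, assoc_mul,
    LinearEquiv.apply_symm_apply]

lemma comul_sourceMap (h : H) : comul (R := k) (sourceMap k H h) =
    comul 1 * ((1 : H) ⊗ₜ[k] sourceMap k H h) := by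
  rw [sourceMap_eq_sliceRight, map_sliceRight, rTensor_comul_comul_one,
    sliceRight_tmul_one_mul_assoc_symm]

lemma comul_sourceMap' (h : H) : comul (R := k) (sourceMap k H h) =
    ((1 : H) ⊗ₜ[k] sourceMap k H h) * comul 1 := by
  rw [sourceMap_eq_sliceRight, map_sliceRight, rTensor_comul_comul_one',
    sliceRight_assoc_symm_mul_tmul_one]

lemma commute_targetMap_sourceMap (g h : H) :
    Commute (targetMap k H g) (sourceMap k H h) := by
  rw [Commute, SemiconjBy, targetMap_eq_sliceLeft, ← sliceLeft_mul_one_tmul,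
    ← sliceLeft_one_tmul_mul, ← comul_sourceMap, comul_sourceMap']

lemma map_sourceMap_targetMap_comul (h : H) :
    TensorProduct.map (sourceMap k H) (targetMap k H) (comul (R := k) h) =
      TensorProduct.comm k H H
        (TensorProduct.map (targetMap k H) (sourceMap k H) (comul (R := k) h)) := by
  let r := ℛ k (1 : H)
  let s := ℛ k h
  have htarget (y : H) : targetMap k H y =
      ∑ j ∈ r.index, counit (R := k) (r.left j * y) • r.right j := by
    simp [targetMap_eq_sliceLeft, ← r.eq]
  have hsource (x : H) : sourceMap k H x =
      ∑ i ∈ r.index, counit (R := k) (x * r.right i) • r.left i := by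
    simp [sourceMap_eq_sliceRight, ← r.eq]
  have hexpand (x y : H) : sourceMap k H x ⊗ₜ[k] targetMap k H y = ∑ p ∈ r.index ×ˢ r.index,
      (counit (R := k) (x * r.right p.1) * counit (R := k) (r.left p.2 * y)) •
        (r.left p.1 ⊗ₜ[k] r.right p.2) := by
    simp only [hsource, htarget, sum_tmul, tmul_sum, smul_tmul_smul, Finset.sum_product]
    exact Finset.sum_comm
  have hcounit (i j : H × H) : ∑ m ∈ s.index,
        counit (R := k) (s.left m * r.right i) * counit (R := k) (r.left j * s.right m) =
      ∑ m ∈ s.index,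
        counit (R := k) (s.right m * r.right i) * counit (R := k) (r.left j * s.left m) := by
    have h₁ := WeakBialgebra.counit_mul_mul (k := k) (r.left j) h (r.right i)
    have h₂ := WeakBialgebra.counit_mul_mul' (k := k) (r.left j) h (r.right i)
    simpa [← s.eq, mul_comm] using h₂.symm.trans h₁
  simp only [← s.eq, map_sum, TensorProduct.map_tmul, TensorProduct.comm_tmul, hexpand]
  rw [Finset.sum_comm, Finset.sum_comm (s := s.index)]
  simp only [← Finset.sum_smul, hcounit]

end WeakBialgebra

section MiddleCounit

variable {k : Type u} {H : Type w} {A : Type v} [Field k] [Ring H] [Algebra k H] [Coalgebra k H]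
  [Ring A] [Algebra k A]

variable (k H A) in
/-- The map `id ⊗ ε ⊗ id : A ⊗ (H ⊗ H) → A ⊗ H`. It is a left inverse of the two maps
`id ⊗ Δ` and `ρ ⊗ id` that a coaction `ρ` equalizes. -/
def middleCounit : A ⊗[k] (H ⊗[k] H) →ₗ[k] A ⊗[k] H :=
  (sliceLeft counit).lTensor A

@[simp] lemma middleCounit_lTensor_comul (x : A ⊗[k] H) :
    middleCounit k H A (comul.lTensor A x) = x := by
  have hcounit : sliceLeft counit ∘ₗ comul (R := k) (A := H) = LinearMap.id := by
    ext h
    simp [sliceLeft]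
  rw [middleCounit, ← LinearMap.lTensor_comp_apply, hcounit,
    LinearMap.lTensor_id_apply]

lemma middleCounit_assoc_tmul (x : A ⊗[k] H) (h : H) :
    middleCounit k H A (TensorProduct.assoc k A H H (x ⊗ₜ[k] h)) =
      sliceRight counit x ⊗ₜ[k] h := by
  induction x with
  | zero => simp
  | tmul a g => simp [middleCounit, smul_tmul]
  | add x y hx hy => simp only [map_add, add_tmul, hx, hy]

lemma middleCounit_one_tmul_comul_mul (x : A ⊗[k] H) :
    middleCounit k H A (((1 : A) ⊗ₜ[k] comul (R := k) (1 : H)) *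
      TensorProduct.assoc k A H H (x ⊗ₜ[k] (1 : H))) = (targetMap k H).lTensor A x := by
  induction x with
  | zero => simp
  | tmul a h => simp [middleCounit, targetMap_eq_sliceLeft, sliceLeft_mul_tmul_one]
  | add x y hx hy => simp only [map_add, add_tmul, mul_add, hx, hy]

lemma middleCounit_mul_one_tmul_comul (x : A ⊗[k] H) :
    middleCounit k H A (TensorProduct.assoc k A H H (x ⊗ₜ[k] (1 : H)) *
      ((1 : A) ⊗ₜ[k] comul (R := k) (1 : H))) = (targetMapOp k H).lTensor A x := by
  induction x with
  | zero => simp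
  | tmul a h => simp [middleCounit, targetMapOp]
  | add x y hx hy => simp only [map_add, add_tmul, add_mul, hx, hy]

end MiddleCounit

section Multiplicative

variable {R A B C : Type*} [CommSemiring R] [Semiring A] [Semiring B] [Semiring C]
  [Algebra R A] [Algebra R B] [Algebra R C]

lemma rTensor_mul_of_map_mul {f : A →ₗ[R] B} (hf : ∀ x y, f (x * y) = f x * f y)
    (u v : A ⊗[R] C) : f.rTensor C (u * v) = f.rTensor C u * f.rTensor C v :=
  LinearMap.map_mul_of_map_mul_tmul (fun _ _ _ _ => by simp [hf]) u v

lemma lTensor_mul_of_map_mul {f : A →ₗ[R] B} (hf : ∀ x y, f (x * y) = f x * f y)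
    (u v : C ⊗[R] A) : f.lTensor C (u * v) = f.lTensor C u * f.lTensor C v :=
  LinearMap.map_mul_of_map_mul_tmul (fun _ _ _ _ => by simp [hf]) u v

end Multiplicative

section WeakBialgebra

variable {k : Type u} {H : Type w} [Field k] [Ring H] [Algebra k H] [WeakBialgebra k H]

lemma middleCounit_one_tmul_mul_assoc_comul_one (v : H ⊗[k] H) :
    middleCounit k H H (((1 : H) ⊗ₜ[k] v) *
      TensorProduct.assoc k H H H (comul (R := k) (1 : H) ⊗ₜ[k] (1 : H))) =
      (sourceMap k H).rTensor H v := by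
  induction v with
  | zero => simp
  | tmul x y =>
    rw [LinearMap.rTensor_tmul, sourceMap_eq_sliceRight]
    induction comul (R := k) (1 : H) with
    | zero => simp
    | tmul a b => simp [middleCounit, smul_tmul]
    | add u v hu hv => simp only [map_add, add_tmul, mul_add, hu, hv]
  | add u v hu hv => simp only [map_add, tmul_add, add_mul, hu, hv]

lemma rTensor_sourceMap_comul (h : H) : (sourceMap k H).rTensor H (comul (R := k) h) =
    ((1 : H) ⊗ₜ[k] h) * comul 1 := by
  rw [← middleCounit_lTensor_comul (((1 : H) ⊗ₜ[k] h) * comul (R := k) (1 : H)),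
    lTensor_mul_of_map_mul WeakBialgebra.comul_mul, WeakBialgebra.comul_comul_one',
    LinearMap.lTensor_tmul, ← mul_assoc, Algebra.TensorProduct.tmul_mul_tmul, one_mul,
    ← WeakBialgebra.comul_mul, mul_one, middleCounit_one_tmul_mul_assoc_comul_one]

variable (k H) in
lemma lTensor_targetMap_comul_one :
    (targetMap k H).lTensor H (comul (R := k) (1 : H)) = comul 1 := by
  rw [← middleCounit_one_tmul_comul_mul, ← WeakBialgebra.comul_comul_one',
    middleCounit_lTensor_comul]

end WeakBialgebra

/-! ### Weak comodule algebras -/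

section ComoduleAlgebra

variable {k : Type u} {H : Type w} {A : Type v} [Field k] [Ring H] [Algebra k H]
  [WeakHopfAlgebra k H] [Ring A] [Algebra k A]

instance : WeakComoduleAlgebra k H H where
  coaction := comul
  coassoc := coassoc_apply
  counit_coaction h := by simp
  coaction_mul := WeakBialgebra.comul_mul
  coaction_one_mem := ⟨(targetMap k H).rangeRestrict.lTensor H (comul 1),
    (LinearMap.lTensor_comp_apply H (targetSpace k H).subtype (targetMap k H).rangeRestrict
      (comul 1)).symm.trans (lTensor_targetMap_comul_one k H)⟩

lemma lTensor_comul_of_mem' {x : A ⊗[k] H}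
    (hx : x ∈ LinearMap.range ((targetSpace k H).subtype.lTensor A)) :
    (comul (R := k) (A := H)).lTensor A x =
      ((1 : A) ⊗ₜ[k] comul (1 : H)) * TensorProduct.assoc k A H H (x ⊗ₜ[k] (1 : H)) := by
  obtain ⟨y, rfl⟩ := hx
  induction y with
  | zero => simp
  | tmul a z =>
    obtain ⟨_, h, rfl⟩ := z
    simp [Algebra.TensorProduct.tmul_mul_tmul, comul_targetMap]
  | add x y hx hy => simp only [map_add, add_tmul, mul_add, hx, hy]

variable [WeakComoduleAlgebra k H A]

lemma rho_mul (a b : A) : rho k H A (a * b) = rho k H A a * rho k H A b :=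
  WeakComoduleAlgebra.coaction_mul a b

lemma middleCounit_assoc_rho (x : A ⊗[k] H) :
    middleCounit k H A (TensorProduct.assoc k A H H ((rho k H A).rTensor H x)) = x := by
  induction x with
  | zero => simp
  | tmul a h =>
    rw [LinearMap.rTensor_tmul, middleCounit_assoc_tmul]
    exact congrArg (· ⊗ₜ[k] h) (WeakComoduleAlgebra.counit_coaction a)
  | add x y hx hy => simp only [map_add, hx, hy]

lemma lTensor_targetMap_rho (a : A) : (targetMap k H).lTensor A (rho k H A a) =
    rho k H A 1 * (a ⊗ₜ[k] (1 : H)) := by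
  rw [← middleCounit_assoc_rho (rho k H A 1 * (a ⊗ₜ[k] (1 : H))), rTensor_mul_of_map_mul rho_mul,
    assoc_mul, WeakComoduleAlgebra.coassoc,
    lTensor_comul_of_mem' WeakComoduleAlgebra.coaction_one_mem, LinearMap.rTensor_tmul,
    mul_assoc, ← assoc_mul, Algebra.TensorProduct.tmul_mul_tmul, ← rho_mul, one_mul, one_mul,
    middleCounit_one_tmul_comul_mul]

lemma lTensor_targetMapOp_rho (a : A) : (targetMapOp k H).lTensor A (rho k H A a) =
    (a ⊗ₜ[k] (1 : H)) * rho k H A 1 := by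
  rw [← middleCounit_assoc_rho ((a ⊗ₜ[k] (1 : H)) * rho k H A 1), rTensor_mul_of_map_mul rho_mul,
    assoc_mul, WeakComoduleAlgebra.coassoc,
    lTensor_comul_of_mem WeakComoduleAlgebra.coaction_one_mem, LinearMap.rTensor_tmul,
    ← mul_assoc, ← assoc_mul, Algebra.TensorProduct.tmul_mul_tmul, ← rho_mul, mul_one, mul_one,
    middleCounit_mul_one_tmul_comul]

lemma mem_coinvariants_of_rho_mem {a : A}
    (ha : rho k H A a ∈ LinearMap.range ((targetSpace k H).subtype.lTensor A)) :
    a ∈ coinvariants k H A := by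
  change rho k H A a = rho k H A 1 * (a ⊗ₜ[k] (1 : H))
  rw [← lTensor_targetMap_rho]
  obtain ⟨y, hy⟩ := ha
  rw [← hy, ← LinearMap.lTensor_comp_apply]
  congr 2
  ext z
  exact (targetMap_of_mem z.2).symm

/-- The action `a ↦ a₀χ(a₁)` on a comodule algebra of a functional `χ` on `H`. For `A = H` it is
the left action `χ ⇀ h = h₁χ(h₂)` of the dual algebra. -/
def dualAction (χ : H →ₗ[k] k) : A →ₗ[k] A :=
  sliceRight χ ∘ₗ rho k H A

@[simp] lemma dualAction_counit (a : A) : dualAction (counit : H →ₗ[k] k) a = a :=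
  WeakComoduleAlgebra.counit_coaction a

lemma rho_dualAction (χ : H →ₗ[k] k) (a : A) : rho k H A (dualAction χ a) =
    (dualAction χ : H →ₗ[k] H).lTensor A (rho k H A a) := by
  rw [dualAction, LinearMap.comp_apply, map_sliceRight, sliceRight_eq_lTensor_assoc,
    WeakComoduleAlgebra.coassoc, ← LinearMap.lTensor_comp_apply]
  rfl

lemma dualAction_dualAction (χ ψ : H →ₗ[k] k) (a : A) :
    dualAction χ (dualAction ψ a) = dualAction (toConv χ * toConv ψ).ofConv a := by
  have hconv : χ ∘ₗ dualAction ψ = (toConv χ * toConv ψ).ofConv := by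
    ext h
    exact apply_sliceRight χ ψ _
  rw [dualAction, LinearMap.comp_apply, rho_dualAction, sliceRight_lTensor, hconv]
  rfl

lemma dualAction_mul (χ : H →ₗ[k] k) (b : coinvariants k H A) (a : A) :
    dualAction χ ((b : A) * a) = (b : A) * dualAction χ a := by
  rw [dualAction, LinearMap.comp_apply, rho_mul, rho_of_mem_coinvariants b.2, mul_assoc,
    ← rho_mul, one_mul, sliceRight_tmul_one_mul]
  rfl

/-- Left integrals of the dual of `H`: the functionals `λ` with `h₁λ(h₂) ∈ H_t` for all `h`. -/
def IsLeftIntegral (χ : H →ₗ[k] k) : Prop :=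
  ∀ h : H, dualAction χ h ∈ targetSpace k H

lemma IsLeftIntegral.dualAction_mem_coinvariants {χ : H →ₗ[k] k} (hχ : IsLeftIntegral χ) (a : A) :
    dualAction χ a ∈ coinvariants k H A := by
  refine mem_coinvariants_of_rho_mem ?_
  rw [rho_dualAction]
  induction rho k H A a with
  | zero => simp
  | tmul a h => exact ⟨a ⊗ₜ ⟨_, hχ h⟩, by simp⟩
  | add x y hx hy => rw [map_add]; exact add_mem hx hy

variable (A) in
/-- The left `B`-linear map `A → B`, `a ↦ a₀λ(a₁)`, of a left integral `λ`. -/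
def IsLeftIntegral.traceMap {χ : H →ₗ[k] k} (hχ : IsLeftIntegral χ) :
    A →ₗ[coinvariants k H A] coinvariants k H A where
  toFun a := ⟨dualAction χ a, hχ.dualAction_mem_coinvariants a⟩
  map_add' a b := Subtype.ext (map_add _ a b)
  map_smul' b a := Subtype.ext (dualAction_mul χ b a)

end ComoduleAlgebra

/-! ### Convolution -/

section Convolution

variable {R C D A B : Type*} [CommRing R] [AddCommGroup C] [Module R C] [Coalgebra R C]
  [AddCommGroup D] [Module R D] [Coalgebra R D] [Ring A] [Algebra R A] [Ring B] [Algebra R B]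

lemma sum_counit_right_smul {c : C} {ι : Type*} (r : Coalgebra.Repr R c ι) :
    ∑ i ∈ r.index, counit (R := R) (r.right i) • r.left i = c := by
  simpa only [map_sum, TensorProduct.rid_tmul, one_smul] using
    congrArg (TensorProduct.rid R C) (sum_tmul_counit_eq r)

/-- Precomposition with a comultiplicative, possibly not counital, linear map `c`, as a
homomorphism of convolution semigroups. -/
def convPrecomp (c : D →ₗ[R] C) (hc : TensorProduct.map c c ∘ₗ comul = comul ∘ₗ c) :
    WithConv (C →ₗ[R] A) →ₙ* WithConv (D →ₗ[R] A) where
  toFun f := toConv (f.ofConv ∘ₗ c)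
  map_mul' f g := by
    ext d
    change LinearMap.mul' R A (TensorProduct.map f.ofConv g.ofConv ((comul ∘ₗ c) d)) =
      LinearMap.mul' R A (TensorProduct.map (f.ofConv ∘ₗ c) (g.ofConv ∘ₗ c) (comul d))
    rw [← hc, TensorProduct.map_comp]
    rfl

/-- Postcomposition with a multiplicative, possibly not unital, linear map `φ`, as a homomorphism
of convolution semigroups. -/
def convPostcomp (φ : A →ₗ[R] B) (hφ : ∀ x y, φ (x * y) = φ x * φ y) :
    WithConv (C →ₗ[R] A) →ₙ* WithConv (C →ₗ[R] B) where
  toFun f := toConv (φ ∘ₗ f.ofConv)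
  map_mul' f g := by
    ext c
    simp [(ℛ R c).convMul_apply, hφ]

variable (R C) in
/-- The linear map `c ↦ ε(c)a`. Convolution with it is multiplication by `a`. -/
def convConst (a : A) : WithConv (C →ₗ[R] A) :=
  toConv ((counit : C →ₗ[R] R).smulRight a)

@[simp] lemma convConst_mul_apply (a : A) (f : WithConv (C →ₗ[R] A)) (c : C) :
    (convConst R C a * f) c = a * f c := by
  have hf := congrArg f (sum_counit_smul (ℛ R c))
  simp only [map_sum, map_smul] at hf
  simp [(ℛ R c).convMul_apply, convConst, ← hf, Finset.mul_sum]

@[simp] lemma mul_convConst_apply (a : A) (f : WithConv (C →ₗ[R] A)) (c : C) :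
    (f * convConst R C a) c = f c * a := by
  have hf := congrArg f (sum_counit_right_smul (ℛ R c))
  simp only [map_sum, map_smul] at hf
  simp [(ℛ R c).convMul_apply, convConst, ← hf, Finset.sum_mul]

lemma convMul_apply_tmul (F G : WithConv (C ⊗[R] D →ₗ[R] A)) {x : C} {y : D} {ι κ : Type*}
    (rx : Coalgebra.Repr R x ι) (ry : Coalgebra.Repr R y κ) :
    (F * G) (x ⊗ₜ[R] y) = ∑ i ∈ rx.index, ∑ j ∈ ry.index,
      F (rx.left i ⊗ₜ[R] ry.left j) * G (rx.right i ⊗ₜ[R] ry.right j) := by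
  rw [LinearMap.convMul_apply, comul_tmul, ← rx.eq, ← ry.eq]
  simp only [sum_tmul, tmul_sum, map_sum]
  rw [Finset.sum_comm]
  simp

variable (R C D) in
/-- The coalgebra map `id ⊗ ε : C ⊗ D → C`. -/
def projLeft : C ⊗[R] D →ₗc[R] C :=
  (Coalgebra.TensorProduct.rid R R C).toCoalgHom.comp
    (Coalgebra.TensorProduct.map (CoalgHom.id R C) (counitCoalgHom R D))

variable (R C D) in
/-- The coalgebra map `ε ⊗ id : C ⊗ D → D`. -/
def projRight : C ⊗[R] D →ₗc[R] D :=
  (Coalgebra.TensorProduct.lid R D).toCoalgHom.comp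
    (Coalgebra.TensorProduct.map (counitCoalgHom R C) (CoalgHom.id R D))

variable (R C D A) in
/-- The homomorphism `f ↦ f ⊗ ε` from functions on `C` to functions on `C ⊗ D`. -/
def convLeft : WithConv (C →ₗ[R] A) →ₙ* WithConv (C ⊗[R] D →ₗ[R] A) :=
  convPrecomp (projLeft R C D).toLinearMap (projLeft R C D).map_comp_comul

variable (R C D A) in
/-- The homomorphism `g ↦ ε ⊗ g` from functions on `D` to functions on `C ⊗ D`. -/
def convRight : WithConv (D →ₗ[R] A) →ₙ* WithConv (C ⊗[R] D →ₗ[R] A) :=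
  convPrecomp (projRight R C D).toLinearMap (projRight R C D).map_comp_comul

@[simp] lemma convLeft_tmul (f : WithConv (C →ₗ[R] A)) (x : C) (y : D) :
    convLeft R C D A f (x ⊗ₜ[R] y) = counit (R := R) y • f x :=
  map_smul f.ofConv _ _

@[simp] lemma convRight_tmul (g : WithConv (D →ₗ[R] A)) (x : C) (y : D) :
    convRight R C D A g (x ⊗ₜ[R] y) = counit (R := R) x • g y :=
  map_smul g.ofConv _ _

lemma mul_convLeft_tmul (F : WithConv (C ⊗[R] D →ₗ[R] A)) (f : WithConv (C →ₗ[R] A)) {x : C}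
    {ι : Type*} (r : Coalgebra.Repr R x ι) (y : D) :
    (F * convLeft R C D A f) (x ⊗ₜ[R] y) =
      ∑ i ∈ r.index, F (r.left i ⊗ₜ[R] y) * f (r.right i) := by
  rw [convMul_apply_tmul _ _ r (ℛ R y)]
  refine Finset.sum_congr rfl fun i _ => ?_
  have hy := congrArg (fun z => F (r.left i ⊗ₜ[R] z)) (sum_counit_right_smul (ℛ R y))
  simp only [tmul_sum, tmul_smul, map_sum, map_smul] at hy
  simp [← hy, Finset.sum_mul]

lemma convRight_mul_tmul (F : WithConv (C ⊗[R] D →ₗ[R] A)) (g : WithConv (D →ₗ[R] A)) (x : C)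
    {y : D} {ι : Type*} (r : Coalgebra.Repr R y ι) :
    (convRight R C D A g * F) (x ⊗ₜ[R] y) =
      ∑ j ∈ r.index, g (r.left j) * F (x ⊗ₜ[R] r.right j) := by
  rw [convMul_apply_tmul _ _ (ℛ R x) r, Finset.sum_comm]
  refine Finset.sum_congr rfl fun j _ => ?_
  have hx := congrArg (fun z => F (z ⊗ₜ[R] r.right j)) (sum_counit_smul (ℛ R x))
  simp only [sum_tmul, ← smul_tmul', map_sum, map_smul] at hx
  simp [← hx, Finset.mul_sum]

lemma convLeft_mul_convRight_tmul (f : WithConv (C →ₗ[R] A)) (g : WithConv (D →ₗ[R] A)) (x : C)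
    (y : D) : (convLeft R C D A f * convRight R C D A g) (x ⊗ₜ[R] y) = f x * g y := by
  have hx := congrArg f (sum_counit_right_smul (ℛ R x))
  have hy := congrArg g (sum_counit_smul (ℛ R y))
  simp only [map_sum, map_smul] at hx hy
  simp [convMul_apply_tmul _ _ (ℛ R x) (ℛ R y), ← hx, ← hy, Finset.sum_mul_sum, mul_comm, smul_smul]

lemma convRight_mul_convLeft_tmul (f : WithConv (C →ₗ[R] A)) (g : WithConv (D →ₗ[R] A)) (x : C)
    (y : D) : (convRight R C D A g * convLeft R C D A f) (x ⊗ₜ[R] y) = g y * f x := by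
  have hx := congrArg f (sum_counit_smul (ℛ R x))
  simp only [map_sum, map_smul] at hx
  simp [mul_convLeft_tmul _ _ (ℛ R x), ← hx, Finset.mul_sum]

end Convolution

/-! ### The antipode -/

section Antipode

variable {k : Type u} {H : Type w} [Field k] [Ring H] [Algebra k H] [WeakHopfAlgebra k H]

variable (k H) in
/-- The antipode `S` of a weak Hopf algebra, with `k` and `H` explicit. -/
abbrev antipode : H →ₗ[k] H := WeakHopfAlgebra.antipode

lemma antipode_convMul_id : toConv (antipode k H) * toConv LinearMap.id =
    toConv (sourceMap k H) := congrArg toConv WeakHopfAlgebra.conv_antipode_id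

lemma id_convMul_antipode : toConv LinearMap.id * toConv (antipode k H) =
    toConv (targetMap k H) := congrArg toConv WeakHopfAlgebra.conv_id_antipode

lemma sourceMap_convMul_antipode : toConv (sourceMap k H) * toConv (antipode k H) =
    toConv (antipode k H) := by
  rw [← antipode_convMul_id]
  exact congrArg toConv WeakHopfAlgebra.conv_antipode_id_antipode

lemma comul_mul_targetMap (g h : H) : comul (R := k) (g * targetMap k H h) =
    comul g * (targetMap k H h ⊗ₜ[k] (1 : H)) := by
  rw [WeakBialgebra.comul_mul, comul_targetMap, ← mul_assoc, ← WeakBialgebra.comul_mul, mul_one]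

lemma comul_sourceMap_mul (g h : H) : comul (R := k) (sourceMap k H g * h) =
    ((1 : H) ⊗ₜ[k] sourceMap k H g) * comul h := by
  rw [WeakBialgebra.comul_mul, comul_sourceMap', mul_assoc, ← WeakBialgebra.comul_mul, one_mul]

lemma sum_mul_targetMap_mul_antipode {g : H} {ι : Type*} (r : Coalgebra.Repr k g ι) (h : H) :
    ∑ i ∈ r.index, r.left i * targetMap k H h * antipode k H (r.right i) =
      targetMap k H (g * h) := by
  have hconv := LinearMap.congr_fun (WeakHopfAlgebra.conv_id_antipode (k := k))
    (g * targetMap k H h)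
  rw [targetMap_mul_targetMap] at hconv
  rw [← hconv, conv, LinearMap.comp_apply, LinearMap.comp_apply, comul_mul_targetMap, ← r.eq]
  simp [Finset.sum_mul]

lemma sum_antipode_mul_sourceMap_mul (g : H) {h : H} {ι : Type*} (r : Coalgebra.Repr k h ι) :
    ∑ i ∈ r.index, antipode k H (r.left i) * (sourceMap k H g * r.right i) =
      sourceMap k H (g * h) := by
  have hconv := LinearMap.congr_fun (WeakHopfAlgebra.conv_antipode_id (k := k))
    (sourceMap k H g * h)
  rw [sourceMap_sourceMap_mul] at hconv
  rw [← hconv, conv, LinearMap.comp_apply, LinearMap.comp_apply, comul_sourceMap_mul, ← r.eq]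
  simp [Finset.mul_sum]

variable (k H) in
lemma map_mul'_comp_comul : TensorProduct.map (LinearMap.mul' k H) (LinearMap.mul' k H) ∘ₗ comul =
    comul ∘ₗ LinearMap.mul' k H := by
  ext x y
  simp only [TensorProduct.AlgebraTensorModule.curry_apply, TensorProduct.curry_apply,
    LinearMap.coe_restrictScalars, LinearMap.comp_apply, LinearMap.mul'_apply,
    WeakBialgebra.comul_mul, comul_tmul]
  rw [← (ℛ k x).eq, ← (ℛ k y).eq]
  rw [Finset.sum_mul_sum, Finset.sum_comm]
  simp [sum_tmul, tmul_sum]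

variable (k H) in
/-- The homomorphism `f ↦ f ∘ μ` from functions on `H` to functions on `H ⊗ H`. -/
def convMulMap : WithConv (H →ₗ[k] H) →ₙ* WithConv (H ⊗[k] H →ₗ[k] H) :=
  convPrecomp (LinearMap.mul' k H) (map_mul'_comp_comul k H)

variable (k H) in
lemma convMulMap_id : convMulMap k H (toConv LinearMap.id) =
    convLeft k H H H (toConv LinearMap.id) * convRight k H H H (toConv LinearMap.id) := by
  ext x y
  exact (convLeft_mul_convRight_tmul (R := k) (toConv LinearMap.id) (toConv LinearMap.id) x y).symm

variable (k H) in
lemma convMulMap_targetMap : convMulMap k H (toConv (targetMap k H)) =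
    convLeft k H H H (toConv LinearMap.id) * convRight k H H H (toConv (targetMap k H)) *
      convLeft k H H H (toConv (antipode k H)) := by
  ext x y
  refine Eq.trans ?_ (mul_convLeft_tmul _ _ (ℛ k x) y).symm
  simp only [convLeft_mul_convRight_tmul]
  exact (sum_mul_targetMap_mul_antipode (ℛ k x) y).symm

variable (k H) in
lemma convMulMap_sourceMap : convMulMap k H (toConv (sourceMap k H)) =
    convRight k H H H (toConv (antipode k H)) *
      (convLeft k H H H (toConv (sourceMap k H)) * convRight k H H H (toConv LinearMap.id)) := by
  ext x y
  refine Eq.trans ?_ (convRight_mul_tmul _ _ x (ℛ k y)).symm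
  simp only [convLeft_mul_convRight_tmul]
  exact (sum_antipode_mul_sourceMap_mul x (ℛ k y)).symm

variable (k H) in
lemma commute_convLeft_sourceMap_convRight_targetMap :
    Commute (convLeft k H H H (toConv (sourceMap k H)))
      (convRight k H H H (toConv (targetMap k H))) := by
  ext x y
  exact (convLeft_mul_convRight_tmul _ _ x y).trans
    ((commute_targetMap_sourceMap y x).eq.symm.trans (convRight_mul_convLeft_tmul _ _ x y).symm)

variable (k H) in
/-- Both sides are generalized inverses of `μ = f ∘ μ` for `f = id`. -/
lemma convMulMap_antipode : convMulMap k H (toConv (antipode k H)) =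
    convRight k H H H (toConv (antipode k H)) * convLeft k H H H (toConv (antipode k H)) := by
  refine generalizedInverse_unique (m := convMulMap k H (toConv LinearMap.id)) ?_ ?_ ?_ ?_
  · rw [← map_mul, antipode_convMul_id, convMulMap_sourceMap, convMulMap_id,
      ← antipode_convMul_id, map_mul]
    simp only [mul_assoc]
  · rw [← map_mul, id_convMul_antipode, convMulMap_targetMap, convMulMap_id,
      ← id_convMul_antipode, map_mul]
    simp only [mul_assoc]
  · rw [← map_mul, ← map_mul, antipode_convMul_id, sourceMap_convMul_antipode]
  · rw [convMulMap_id]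
    refine mul_generalizedInverse ?_ ?_ ?_
    · rw [← map_mul, ← map_mul, antipode_convMul_id, id_convMul_antipode]
      exact commute_convLeft_sourceMap_convRight_targetMap k H
    all_goals rw [← map_mul, ← map_mul, antipode_convMul_id, sourceMap_convMul_antipode]

lemma antipode_mul (g h : H) : antipode k H (g * h) = antipode k H h * antipode k H g :=
  (congrArg (fun f => f (g ⊗ₜ[k] h)) (convMulMap_antipode k H)).trans
    (convRight_mul_convLeft_tmul _ _ g h)

variable (k H) in
/-- The homomorphism `f ↦ (h ↦ f(h) ⊗ 1)`. -/
def convInclLeft : WithConv (H →ₗ[k] H) →ₙ* WithConv (H →ₗ[k] H ⊗[k] H) :=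
  convPostcomp (Algebra.TensorProduct.includeLeft : H →ₐ[k] H ⊗[k] H).toLinearMap
    (map_mul (Algebra.TensorProduct.includeLeft : H →ₐ[k] H ⊗[k] H))

variable (k H) in
/-- The homomorphism `f ↦ (h ↦ 1 ⊗ f(h))`. -/
def convInclRight : WithConv (H →ₗ[k] H) →ₙ* WithConv (H →ₗ[k] H ⊗[k] H) :=
  convPostcomp (Algebra.TensorProduct.includeRight : H →ₐ[k] H ⊗[k] H).toLinearMap
    (map_mul (Algebra.TensorProduct.includeRight : H →ₐ[k] H ⊗[k] H))

variable (k H) in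
/-- The homomorphism `f ↦ Δ ∘ f`. -/
def convComul : WithConv (H →ₗ[k] H) →ₙ* WithConv (H →ₗ[k] H ⊗[k] H) :=
  convPostcomp comul WeakBialgebra.comul_mul

lemma convInclLeft_mul_convInclRight_apply (f g : WithConv (H →ₗ[k] H)) (h : H) :
    (convInclLeft k H f * convInclRight k H g) h =
      TensorProduct.map f.ofConv g.ofConv (comul (R := k) h) := by
  rw [(ℛ k h).convMul_apply]
  conv_rhs => rw [← (ℛ k h).eq]
  simp [convInclLeft, convInclRight, convPostcomp]

lemma convInclRight_mul_convInclLeft_apply (f g : WithConv (H →ₗ[k] H)) (h : H) :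
    (convInclRight k H g * convInclLeft k H f) h =
      TensorProduct.map f.ofConv g.ofConv (TensorProduct.comm k H H (comul (R := k) h)) := by
  rw [(ℛ k h).convMul_apply]
  conv_rhs => rw [← (ℛ k h).eq]
  simp [convInclLeft, convInclRight, convPostcomp]

variable (k H) in
lemma convComul_id : convComul k H (toConv LinearMap.id) =
    convInclLeft k H (toConv LinearMap.id) * convInclRight k H (toConv LinearMap.id) := by
  ext h
  rw [convInclLeft_mul_convInclRight_apply, ofConv_toConv, TensorProduct.map_id]
  rfl

variable (k H) in
lemma convInclLeft_id_mul_convInclRight_targetMap :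
    convInclLeft k H (toConv LinearMap.id) * convInclRight k H (toConv (targetMap k H)) =
      convConst k H (comul (R := k) 1) * convInclLeft k H (toConv LinearMap.id) := by
  ext h
  rw [convInclLeft_mul_convInclRight_apply, convConst_mul_apply]
  exact lTensor_targetMap_rho (A := H) h

variable (k H) in
lemma convInclLeft_sourceMap_mul_convInclRight_id :
    convInclLeft k H (toConv (sourceMap k H)) * convInclRight k H (toConv LinearMap.id) =
      convInclRight k H (toConv LinearMap.id) * convConst k H (comul (R := k) 1) := by
  ext h
  rw [convInclLeft_mul_convInclRight_apply, mul_convConst_apply]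
  exact rTensor_sourceMap_comul h

variable (k H) in
lemma convComul_targetMap : convComul k H (toConv (targetMap k H)) =
    convConst k H (comul (R := k) 1) * convInclLeft k H (toConv (targetMap k H)) := by
  ext h
  rw [convConst_mul_apply]
  exact comul_targetMap h

variable (k H) in
lemma convComul_sourceMap : convComul k H (toConv (sourceMap k H)) =
    convConst k H (comul (R := k) 1) * convInclRight k H (toConv (sourceMap k H)) := by
  ext h
  rw [convConst_mul_apply]
  exact comul_sourceMap h

variable (k H) in
lemma convComul_sourceMap' : convComul k H (toConv (sourceMap k H)) =
    convInclRight k H (toConv (sourceMap k H)) * convConst k H (comul (R := k) 1) := by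
  ext h
  rw [mul_convConst_apply]
  exact comul_sourceMap' h

variable (k H) in
lemma commute_convInclLeft_sourceMap_convInclRight_targetMap :
    Commute (convInclLeft k H (toConv (sourceMap k H)))
      (convInclRight k H (toConv (targetMap k H))) := by
  ext h
  rw [convInclLeft_mul_convInclRight_apply, convInclRight_mul_convInclLeft_apply,
    TensorProduct.map_comm]
  exact map_sourceMap_targetMap_comul h

variable (k H) in
/-- Both sides are generalized inverses of `Δ = Δ ∘ f` for `f = id`. -/
lemma convComul_antipode : convComul k H (toConv (antipode k H)) =
    convInclRight k H (toConv (antipode k H)) * convInclLeft k H (toConv (antipode k H)) := by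
  refine generalizedInverse_unique (m := convComul k H (toConv LinearMap.id)) ?_ ?_ ?_ ?_
  · rw [← map_mul, antipode_convMul_id, convComul_sourceMap', ← antipode_convMul_id, map_mul,
      mul_assoc, ← convInclLeft_sourceMap_mul_convInclRight_id, convComul_id,
      ← antipode_convMul_id, map_mul]
    simp only [mul_assoc]
  · rw [← map_mul, id_convMul_antipode, convComul_targetMap, ← id_convMul_antipode, map_mul,
      ← mul_assoc, ← convInclLeft_id_mul_convInclRight_targetMap, convComul_id,
      ← id_convMul_antipode, map_mul]
    simp only [mul_assoc]
  · rw [← map_mul, ← map_mul, antipode_convMul_id, sourceMap_convMul_antipode]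
  · rw [convComul_id]
    refine mul_generalizedInverse ?_ ?_ ?_
    · rw [← map_mul, ← map_mul, antipode_convMul_id, id_convMul_antipode]
      exact commute_convInclLeft_sourceMap_convInclRight_targetMap k H
    all_goals rw [← map_mul, ← map_mul, antipode_convMul_id, sourceMap_convMul_antipode]

lemma comul_antipode (h : H) : comul (R := k) (antipode k H h) =
    TensorProduct.map (antipode k H) (antipode k H) (TensorProduct.comm k H H (comul h)) :=
  (congrArg (fun f => f h) (convComul_antipode k H)).trans
    (convInclRight_mul_convInclLeft_apply _ _ h)

variable (k H) in
lemma convComul_antipode_mul_convInclLeft_id :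
    convComul k H (toConv (antipode k H)) * convInclLeft k H (toConv LinearMap.id) =
      convConst k H (comul (R := k) 1) * convInclRight k H (toConv (antipode k H)) := by
  have mul_comul_one : convComul k H (toConv (antipode k H)) * convConst k H (comul (R := k) 1) =
      convComul k H (toConv (antipode k H)) := by
    ext h
    rw [mul_convConst_apply]
    exact (WeakBialgebra.comul_mul _ _).symm.trans (congrArg comul (mul_one _))
  rw [← mul_comul_one, mul_assoc, ← convInclLeft_id_mul_convInclRight_targetMap,
    ← id_convMul_antipode, map_mul, ← mul_assoc (convInclLeft k H _), ← convComul_id, ← mul_assoc,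
    ← map_mul, antipode_convMul_id, convComul_sourceMap, mul_assoc, ← map_mul,
    sourceMap_convMul_antipode]

end Antipode

/-! ### Integrals -/

section DualBasis

variable {R V C ι : Type*} [CommRing R] [AddCommGroup V] [Module R V] [AddCommGroup C] [Module R C]
  [Fintype ι] (e : Module.Basis ι R C)

lemma sliceRight_sum (χ : ι → C →ₗ[R] R) (u : V ⊗[R] C) :
    sliceRight (∑ j, χ j) u = ∑ j, sliceRight (χ j) u := by
  induction u with
  | zero => simp
  | tmul x y => simp [Finset.sum_smul]
  | add u v hu hv => simp only [map_add, hu, hv, Finset.sum_add_distrib]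

lemma sum_smul_sliceRight_coord (χ : C →ₗ[R] R) (u : V ⊗[R] C) :
    ∑ j, χ (e j) • sliceRight (e.coord j) u = sliceRight χ u := by
  conv_rhs => rw [← e.sum_dual_apply_smul_coord χ]
  rw [sliceRight_sum]
  refine Finset.sum_congr rfl fun j _ => ?_
  induction u with
  | zero => simp
  | tmul x y => simp [smul_smul]
  | add u v hu hv => simp only [map_add, smul_add, hu, hv]

lemma sum_mul'_map_coord_smul (u : C ⊗[R] C) :
    ∑ a, ∑ b, LinearMap.mul' R R (TensorProduct.map (e.coord a) (e.coord b) u) •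
      e a ⊗ₜ[R] e b = u := by
  induction u with
  | zero => simp
  | tmul x y =>
    simp only [TensorProduct.map_tmul, LinearMap.mul'_apply, Module.Basis.coord_apply,
      ← smul_tmul_smul, ← tmul_sum, ← sum_tmul, e.sum_repr]
  | add u v hu hv => simp only [map_add, add_smul, Finset.sum_add_distrib, hu, hv]

lemma sum_sliceRight_coord_comul [Coalgebra R C] (G : C ⊗[R] C →ₗ[R] V ⊗[R] C) :
    ∑ j, sliceRight (e.coord j) (G (comul (e j))) =
      ∑ a, ∑ b, sliceRight (toConv (e.coord a) * toConv (e.coord b)).ofConv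
        (G (e a ⊗ₜ[R] e b)) := by
  have expand_comul (j : ι) : sliceRight (e.coord j) (G (comul (e j))) =
      ∑ a, ∑ b, (toConv (e.coord a) * toConv (e.coord b)).ofConv (e j) •
        sliceRight (e.coord j) (G (e a ⊗ₜ[R] e b)) := by
    rw [← sum_mul'_map_coord_smul e (comul (e j))]
    simp only [map_sum, map_smul]
    rfl
  have expand_conv (a b : ι) : sliceRight (toConv (e.coord a) * toConv (e.coord b)).ofConv
      (G (e a ⊗ₜ[R] e b)) = ∑ j, (toConv (e.coord a) * toConv (e.coord b)).ofConv (e j) •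
        sliceRight (e.coord j) (G (e a ⊗ₜ[R] e b)) :=
    (sum_smul_sliceRight_coord e _ _).symm
  simp only [expand_comul, expand_conv]
  rw [Finset.sum_comm_cycle, Finset.sum_comm_cycle]

end DualBasis

section Integrals

variable {k : Type u} {H : Type w} [Field k] [Ring H] [Algebra k H] [WeakHopfAlgebra k H]

lemma sum_mul_antipode {h : H} {ι : Type*} (r : Coalgebra.Repr k h ι) :
    ∑ i ∈ r.index, r.left i * antipode k H (r.right i) = targetMap k H h :=
  (r.convMul_apply (toConv LinearMap.id) (toConv (antipode k H))).symm.trans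
    (LinearMap.congr_fun WeakHopfAlgebra.conv_id_antipode h)

lemma sum_antipode_mul {h : H} {ι : Type*} (r : Coalgebra.Repr k h ι) :
    ∑ i ∈ r.index, antipode k H (r.left i) * r.right i = sourceMap k H h :=
  (r.convMul_apply (toConv (antipode k H)) (toConv LinearMap.id)).symm.trans
    (LinearMap.congr_fun WeakHopfAlgebra.conv_antipode_id h)

lemma sum_comul_mul_antipode_tmul_one (h : H) {g : H} {ι : Type*} (r : Coalgebra.Repr k g ι) :
    ∑ i ∈ r.index, comul (R := k) (h * antipode k H (antipode k H (r.right i))) *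
      (antipode k H (r.left i) ⊗ₜ[k] (1 : H)) =
      comul h * ((1 : H) ⊗ₜ[k] antipode k H (antipode k H g)) := by
  let s : Coalgebra.Repr k (antipode k H g) ι :=
    { index := r.index
      left := fun i => antipode k H (r.right i)
      right := fun i => antipode k H (r.left i)
      eq := by rw [comul_antipode, ← r.eq]; simp }
  have key : (convComul k H (toConv (antipode k H)) * convInclLeft k H (toConv LinearMap.id))
      (antipode k H g) = comul (1 : H) * ((1 : H) ⊗ₜ[k] antipode k H (antipode k H g)) := by
    rw [convComul_antipode_mul_convInclLeft_id, convConst_mul_apply]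
    rfl
  rw [s.convMul_apply] at key
  calc _ = comul h * ∑ i ∈ s.index, comul (R := k) (antipode k H (s.left i)) *
        (s.right i ⊗ₜ[k] (1 : H)) := by
        simp only [Finset.mul_sum, ← mul_assoc, ← WeakBialgebra.comul_mul]
        rfl
    _ = comul h * (comul (1 : H) * ((1 : H) ⊗ₜ[k] antipode k H (antipode k H g))) :=
        congrArg (comul h * ·) key
    _ = _ := by rw [← mul_assoc, ← WeakBialgebra.comul_mul, mul_one]

variable {ι : Type*} [Fintype ι] (e : Module.Basis ι k H)

lemma sum_dualAction_coord_mul_antipode (h : H) :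
    ∑ a, dualAction (e.coord a) h * antipode k H (e a) = targetMap k H h := by
  have hS (x : H) : ∑ a, e.coord a x • antipode k H (e a) = antipode k H x := by
    simp only [← map_smul, ← map_sum, Module.Basis.coord_apply, e.sum_repr]
  have hdual (χ : H →ₗ[k] k) : dualAction χ h =
      ∑ i ∈ (ℛ k h).index, χ ((ℛ k h).right i) • (ℛ k h).left i := by
    change sliceRight χ (comul (R := k) h) = _
    conv_lhs => rw [← (ℛ k h).eq]
    simp only [map_sum, sliceRight_tmul]
  simp only [hdual, Finset.sum_mul, smul_mul_assoc]
  rw [Finset.sum_comm]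
  simp only [← mul_smul_comm, ← Finset.mul_sum, hS, sum_mul_antipode]

/-- The functional `h ↦ ∑ eʲ(φ ⇀ hS²(eⱼ))`, for dual bases `eⱼ` and `eʲ`: the trace of the
endomorphism `g ↦ φ ⇀ hS²(g)` of `H`. -/
def traceIntegral (φ : H →ₗ[k] k) : H →ₗ[k] k :=
  ∑ j, e.coord j ∘ₗ dualAction φ ∘ₗ LinearMap.mulRight k (antipode k H (antipode k H (e j)))

lemma lTensor_dualAction_comul_mul (φ : H →ₗ[k] k) (g h : H) :
    (dualAction φ : H →ₗ[k] H).lTensor H (comul (R := k) h * (g ⊗ₜ[k] (1 : H))) =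
      comul (R := k) (dualAction φ h) * (g ⊗ₜ[k] (1 : H)) := by
  change _ = rho k H H (dualAction φ h) * _
  rw [rho_dualAction]
  change _ = (dualAction φ : H →ₗ[k] H).lTensor H (comul (R := k) h) * _
  induction comul (R := k) h with
  | zero => simp
  | tmul x y => simp
  | add u v hu hv => simp only [add_mul, map_add, hu, hv]

lemma dualAction_traceIntegral (φ : H →ₗ[k] k) (h : H) :
    dualAction (traceIntegral e φ) h = ∑ b, targetMap k H (dualAction (e.coord b)
      (dualAction φ (h * antipode k H (antipode k H (e b))))) := by
  let G : H ⊗[k] H →ₗ[k] H ⊗[k] H := TensorProduct.lift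
    ((LinearMap.mul k (H ⊗[k] H)).flip.compl₁₂
      (Algebra.TensorProduct.includeLeft.toLinearMap ∘ₗ antipode k H)
      (comul ∘ₗ dualAction φ ∘ₗ LinearMap.mulLeft k h ∘ₗ antipode k H ∘ₗ antipode k H))
  have hG (x y : H) : G (x ⊗ₜ[k] y) =
      comul (R := k) (dualAction φ (h * antipode k H (antipode k H y))) *
        (antipode k H x ⊗ₜ[k] (1 : H)) := rfl
  have slice_comul (j : ι) : sliceRight (e.coord j ∘ₗ dualAction φ ∘ₗ
      LinearMap.mulRight k (antipode k H (antipode k H (e j)))) (comul (R := k) h) =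
      sliceRight (e.coord j) (G (comul (R := k) (e j))) := by
    rw [← LinearMap.comp_assoc, ← sliceRight_mul_one_tmul, ← sliceRight_lTensor,
      ← sum_comul_mul_antipode_tmul_one h (ℛ k (e j)), ← (ℛ k (e j)).eq]
    simp only [map_sum, lTensor_dualAction_comul_mul, hG]
  have slice_basis (a b : ι) : sliceRight (toConv (e.coord a) * toConv (e.coord b)).ofConv
      (G (e a ⊗ₜ[k] e b)) = dualAction (e.coord a) (dualAction (e.coord b)
        (dualAction φ (h * antipode k H (antipode k H (e b))))) * antipode k H (e a) := by
    rw [dualAction_dualAction, hG, sliceRight_mul_tmul_one]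
    rfl
  calc dualAction (traceIntegral e φ) h
      = ∑ j, sliceRight (e.coord j) (G (comul (R := k) (e j))) := by
        simp only [← slice_comul]
        exact sliceRight_sum _ _
    _ = ∑ b, ∑ a, dualAction (e.coord a) (dualAction (e.coord b)
        (dualAction φ (h * antipode k H (antipode k H (e b))))) * antipode k H (e a) := by
        rw [sum_sliceRight_coord_comul, Finset.sum_comm]
        simp only [slice_basis]
    _ = _ := by simp only [sum_dualAction_coord_mul_antipode]

lemma isLeftIntegral_traceIntegral (φ : H →ₗ[k] k) : IsLeftIntegral (traceIntegral e φ) :=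
  fun h => dualAction_traceIntegral e φ h ▸ sum_mem fun _ _ => LinearMap.mem_range_self _ _

lemma sum_coord_mul_antipode_sourceMap (h : H) :
    ∑ j, e.coord j (h * antipode k H (sourceMap k H (e j))) = counit (R := k) h := by
  have hsource (x : H) : sourceMap k H x = ∑ i ∈ (ℛ k (1 : H)).index,
      counit (R := k) (x * (ℛ k (1 : H)).right i) • (ℛ k (1 : H)).left i := by
    rw [sourceMap_eq_sliceRight, ← (ℛ k (1 : H)).eq]
    simp
  have hcoord (g y : H) :
      ∑ j, counit (R := k) (e j * y) * e.coord j g = counit (R := k) (g * y) := by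
    simpa using LinearMap.congr_fun
      (e.sum_dual_apply_smul_coord (counit ∘ₗ LinearMap.mulRight k y)) g
  simp only [hsource, map_sum, map_smul, Finset.mul_sum, mul_smul_comm, smul_eq_mul]
  rw [Finset.sum_comm]
  simp only [hcoord, mul_assoc, ← map_sum, ← Finset.mul_sum, sum_antipode_mul, sourceMap_one,
    mul_one]

lemma sum_traceIntegral_coord (h : H) :
    ∑ i, traceIntegral e (e.coord i) (h * antipode k H (e i)) = counit (R := k) h := by
  let G : H ⊗[k] H →ₗ[k] H := LinearMap.mulLeft k h ∘ₗ antipode k H ∘ₗ LinearMap.mul' k H ∘ₗ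
    TensorProduct.map (antipode k H) LinearMap.id
  have hG (x : H) : G (comul (R := k) x) = h * antipode k H (sourceMap k H x) := by
    rw [← WeakHopfAlgebra.conv_antipode_id]
    rfl
  have hbasis (a b : ι) : G (e a ⊗ₜ[k] e b) =
      h * antipode k H (e b) * antipode k H (antipode k H (e a)) := by
    simp [G, antipode_mul, mul_assoc]
  have hconv (a b : ι) (x : H) : e.coord a (dualAction (e.coord b) x) =
      (toConv (e.coord a) * toConv (e.coord b)).ofConv x := apply_sliceRight _ _ _
  have key := sum_sliceRight_coord_comul e (TensorProduct.mk k k H 1 ∘ₗ G)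
  simp only [LinearMap.comp_apply, TensorProduct.mk_apply, sliceRight_tmul, smul_eq_mul, mul_one,
    hG, hbasis, sum_coord_mul_antipode_sourceMap, ← hconv] at key
  rw [key, Finset.sum_comm]
  simp [traceIntegral]

end Integrals

section Semisimple

variable (k : Type u) (H : Type w) [Field k] [Ring H] [Algebra k H] [WeakBialgebra k H]

lemma exists_normalized_integral [IsSemisimpleRing H] :
    ∃ t : H, (∀ h, t * h = t * sourceMap k H h) ∧ sourceMap k H t = 1 := by
  let J : Submodule Hᵐᵒᵖ H :=
    { (sourceMap k H).ker with
      smul_mem' := fun c x hx => by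
        change sourceMap k H (x * c.unop) = 0
        rw [← sourceMap_sourceMap_mul, show sourceMap k H x = 0 from hx, zero_mul, map_zero] }
  obtain ⟨K, hK⟩ := exists_isCompl J
  obtain ⟨j, hj, t, ht, hjt⟩ :=
    Submodule.mem_sup.1 (hK.sup_eq_top ▸ Submodule.mem_top (x := (1 : H)))
  have mul_eq_zero {x : H} (hx : x ∈ J) : t * x = 0 := by
    refine Submodule.disjoint_def.1 hK.disjoint _ ?_ (K.smul_mem (MulOpposite.op x) ht)
    rw [eq_sub_of_add_eq' hjt, sub_mul, one_mul]
    exact J.sub_mem hx (J.smul_mem (MulOpposite.op x) hj)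
  refine ⟨t, fun h => ?_, ?_⟩
  · rw [← sub_eq_zero, ← mul_sub]
    refine mul_eq_zero (show sourceMap k H _ = 0 from ?_)
    rw [map_sub, sourceMap_sourceMap, sub_self]
  · rw [eq_sub_of_add_eq' hjt, map_sub, show sourceMap k H j = 0 from hj, sub_zero, sourceMap_one]

end Semisimple

/-! ### Induction along a subalgebra -/

section Induction

variable {k : Type u} {A : Type v} [Field k] [Ring A] [Algebra k A] (B : Subalgebra k A)

section Module

variable (M : Type w₁) [AddCommGroup M] [Module B M]

lemma smul_mem_balancedRel (a : A) {x : A ⊗[ℤ] M} (hx : x ∈ balancedRel B M) :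
    a • x ∈ balancedRel B M := by
  suffices balancedRel B M ≤ (balancedRel B M).comap (DistribSMul.toAddMonoidHom (A ⊗[ℤ] M) a) from
    this hx
  refine (AddSubgroup.closure_le _).2 ?_
  rintro _ ⟨a', b, m, rfl⟩
  refine AddSubgroup.subset_closure ⟨a * a', b, m, ?_⟩
  rw [DistribSMul.toAddMonoidHom_apply, smul_sub, smul_tmul', smul_tmul', smul_eq_mul,
    smul_eq_mul, mul_assoc]

instance : SMul A (BalancedTensor B M) where
  smul a := QuotientAddGroup.map (balancedRel B M) (balancedRel B M)
    (DistribSMul.toAddMonoidHom (A ⊗[ℤ] M) a) fun _ => smul_mem_balancedRel B M a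

instance : Module A (BalancedTensor B M) :=
  Function.Surjective.module A (QuotientAddGroup.mk' (balancedRel B M))
    (QuotientAddGroup.mk'_surjective _) fun _ _ => rfl

end Module

variable {M : Type w₁} [AddCommGroup M] [Module B M] {N : Type w₂} [AddCommGroup N]

/-- The element `a ⊗ m` of `A ⊗_B M`. -/
def balancedTmul (a : A) (m : M) : BalancedTensor B M := QuotientAddGroup.mk (a ⊗ₜ[ℤ] m)

lemma smul_balancedTmul (a a' : A) (m : M) :
    a • balancedTmul B a' m = balancedTmul B (a * a') m := rfl

lemma smul_balancedTmul_one (a : A) (m : M) : a • balancedTmul B 1 m = balancedTmul B a m := by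
  rw [smul_balancedTmul, mul_one]

lemma balancedTmul_add (a : A) (m m' : M) :
    balancedTmul B a (m + m') = balancedTmul B a m + balancedTmul B a m' :=
  congrArg QuotientAddGroup.mk (tmul_add a m m')

lemma balancedTmul_smul (a : A) (b : B) (m : M) :
    balancedTmul B a (b • m) = balancedTmul B (a * (b : A)) m := by
  refine Eq.symm (sub_eq_zero.1 ?_)
  exact (QuotientAddGroup.eq_zero_iff _).2 (AddSubgroup.subset_closure ⟨a, b, m, rfl⟩)

@[elab_as_elim]
lemma balancedTensor_induction {P : BalancedTensor B M → Prop} (z : BalancedTensor B M)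
    (zero : P 0) (tmul : ∀ a m, P (balancedTmul B a m)) (add : ∀ x y, P x → P y → P (x + y)) :
    P z := by
  obtain ⟨z, rfl⟩ := QuotientAddGroup.mk_surjective z
  induction z with
  | zero => exact zero
  | tmul a m => exact tmul a m
  | add x y hx hy => exact add _ _ hx hy

lemma exists_eq_sum_balancedTmul (z : BalancedTensor B M) :
    ∃ s : Finset (A × M), z = ∑ p ∈ s, balancedTmul B p.1 p.2 := by
  obtain ⟨z, rfl⟩ := QuotientAddGroup.mk_surjective z
  obtain ⟨s, rfl⟩ := TensorProduct.exists_finset z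
  exact ⟨s, map_sum (QuotientAddGroup.mk' (balancedRel B M)) _ _⟩

lemma balancedTensor_addHom_ext {G : Type*} [AddZeroClass G] {f g : BalancedTensor B M →+ G}
    (h : ∀ a m, f (balancedTmul B a m) = g (balancedTmul B a m)) : f = g :=
  AddMonoidHom.ext fun z => by
    induction z using balancedTensor_induction with
    | zero => rw [map_zero, map_zero]
    | tmul a m => exact h a m
    | add x y hx hy => rw [map_add, map_add, hx, hy]

lemma balancedTensor_hom_ext [Module A N] {f g : BalancedTensor B M →ₗ[A] N}
    (h : ∀ m, f (balancedTmul B 1 m) = g (balancedTmul B 1 m)) : f = g := by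
  refine LinearMap.toAddMonoidHom_injective (balancedTensor_addHom_ext B fun a m => ?_)
  simp only [LinearMap.toAddMonoidHom_coe, ← smul_balancedTmul_one B a m, map_smul, h]

/-- The unit `m ↦ 1 ⊗ m` of the adjunction between induction `A ⊗_B -` and restriction. -/
def balancedUnit : M →ₗ[B] BalancedTensor B M where
  toFun := balancedTmul B 1
  map_add' := balancedTmul_add B 1
  map_smul' b m := by
    rw [balancedTmul_smul, one_mul]
    exact (smul_balancedTmul_one B (b : A) m).symm

/-- The map `a ⊗ m ↦ a f(m)` from `A ⊗_B M` to an `A`-module which corresponds to a `B`-linear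
map `f` under the adjunction between induction and restriction. -/
def balancedLift [Module A N] (f : M →ₗ[B] N) : BalancedTensor B M →ₗ[A] N where
  toFun := QuotientAddGroup.lift (balancedRel B M)
    (TensorProduct.liftAddHom ((smulAddHom A N).flip.comp f.toAddMonoidHom).flip
      (biadditive_zsmul _)) <| by
    refine (AddSubgroup.closure_le _).2 ?_
    rintro _ ⟨a, b, m, rfl⟩
    rw [SetLike.mem_coe, AddMonoidHom.mem_ker, map_sub, sub_eq_zero]
    change (a * (b : A)) • f m = a • f (b • m)
    rw [map_smul, mul_smul]
    rfl
  map_add' := map_add _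
  map_smul' a z := by
    induction z using balancedTensor_induction with
    | zero => rw [smul_zero, map_zero, smul_zero]
    | tmul a' m => exact mul_smul a a' (f m)
    | add x y hx hy => rw [smul_add, map_add, hx, hy, map_add, smul_add]

lemma balancedLift_tmul [Module A N] (f : M →ₗ[B] N) (a : A) (m : M) :
    balancedLift B f (balancedTmul B a m) = a • f m := rfl

variable [Module B N]

/-- `balancedMap` as an `A`-linear map. -/
def balancedMapₗ (f : M →ₗ[B] N) : BalancedTensor B M →ₗ[A] BalancedTensor B N where
  __ := balancedMap B f
  map_smul' a z := by
    change balancedMap B f (a • z) = a • balancedMap B f z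
    induction z using balancedTensor_induction with
    | zero => rw [smul_zero, map_zero, smul_zero]
    | tmul => rfl
    | add x y hx hy => rw [smul_add, map_add, hx, hy, map_add, smul_add]

lemma balancedMapₗ_tmul (f : M →ₗ[B] N) (a : A) (m : M) :
    balancedMapₗ B f (balancedTmul B a m) = balancedTmul B a (f m) := rfl

lemma balancedMapₗ_add (f g : M →ₗ[B] N) :
    balancedMapₗ B (f + g) = balancedMapₗ B f + balancedMapₗ B g :=
  balancedTensor_hom_ext B fun m => balancedTmul_add B 1 (f m) (g m)

lemma balancedMapₗ_comp {P : Type*} [AddCommGroup P] [Module B P] (g : N →ₗ[B] P)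
    (f : M →ₗ[B] N) : balancedMapₗ B (g ∘ₗ f) = balancedMapₗ B g ∘ₗ balancedMapₗ B f :=
  balancedTensor_hom_ext B fun _ => rfl

lemma finite_balancedTensor [Module.Finite B M] : Module.Finite A (BalancedTensor B M) := by
  classical
  obtain ⟨s, hs⟩ := Module.Finite.fg_top (R := B) (M := M)
  let T := Submodule.span A (s.image (balancedTmul B 1) : Set (BalancedTensor B M))
  have unit_mem (m : M) : balancedTmul B 1 m ∈ T := by
    suffices Submodule.span B s ≤ (T.restrictScalars B).comap (balancedUnit B) from
      this (hs ▸ Submodule.mem_top)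
    exact Submodule.span_le.2 fun m hm =>
      Submodule.subset_span (Finset.mem_image_of_mem _ hm)
  refine ⟨⟨s.image (balancedTmul B 1), eq_top_iff.2 fun z _ => ?_⟩⟩
  induction z using balancedTensor_induction with
  | zero => exact zero_mem _
  | tmul a m => exact smul_balancedTmul_one B a m ▸ T.smul_mem a (unit_mem m)
  | add x y hx hy => exact add_mem (hx trivial) (hy trivial)

end Induction

section Separability

variable {k : Type u} {A : Type v} [Field k] [Ring A] [Algebra k A] {B : Subalgebra k A}

/-- A separability element of the extension `A/B`: an element `∑ xᵢ ⊗ yᵢ` of `A ⊗_B A` such that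
`∑ xᵢyᵢ = 1` and `∑ axᵢ ⊗ yᵢ = ∑ xᵢ ⊗ yᵢa` for all `a`. -/
structure IsSeparabilityElement (e : BalancedTensor B A) : Prop where
  lift_eq_one : balancedLift B (LinearMap.id : A →ₗ[B] A) e = 1
  smul_eq (a : A) :
    a • e = balancedMapₗ B ((LinearMap.toSpanSingleton A A a).restrictScalars B) e

variable {e : BalancedTensor B A} {N : Type w₂} [AddCommGroup N] [Module A N]

/-- The section `n ↦ ∑ xᵢ ⊗ yᵢn` of the multiplication map `A ⊗_B N → N`. -/
def IsSeparabilityElement.toBalancedTensor (he : IsSeparabilityElement e) :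
    N →ₗ[A] BalancedTensor B N where
  toFun n := balancedMapₗ B ((LinearMap.toSpanSingleton A N n).restrictScalars B) e
  map_add' m n := by
    rw [LinearMap.toSpanSingleton_add, LinearMap.restrictScalars_add, balancedMapₗ_add]
    rfl
  map_smul' a n := by
    have hcomp : (LinearMap.toSpanSingleton A N (a • n)).restrictScalars B =
        (LinearMap.toSpanSingleton A N n).restrictScalars B ∘ₗ
          (LinearMap.toSpanSingleton A A a).restrictScalars B :=
      LinearMap.ext fun x => (mul_smul x a n).symm
    rw [hcomp, balancedMapₗ_comp, LinearMap.comp_apply, ← he.smul_eq, map_smul]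
    rfl

lemma IsSeparabilityElement.balancedLift_toBalancedTensor (he : IsSeparabilityElement e) (n : N) :
    balancedLift B (LinearMap.id : N →ₗ[B] N) (he.toBalancedTensor n) = n := by
  have hcomp : balancedLift B (LinearMap.id : N →ₗ[B] N) ∘ₗ
      balancedMapₗ B ((LinearMap.toSpanSingleton A N n).restrictScalars B) =
      LinearMap.toSpanSingleton A N n ∘ₗ balancedLift B (LinearMap.id : A →ₗ[B] A) :=
    balancedTensor_hom_ext B fun a => by
      simp [balancedLift_tmul, balancedMapₗ_tmul]
  have key := LinearMap.congr_fun hcomp e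
  rwa [LinearMap.comp_apply, LinearMap.comp_apply, he.lift_eq_one,
    LinearMap.toSpanSingleton_apply, one_smul] at key

end Separability

/-! ### Weak Galois extensions -/

section DualBasis

variable {R M ι : Type*} [Ring R] [AddCommGroup M] [Module R M] [Fintype ι] {f : ι → M →ₗ[R] R}
  {y : ι → M}

lemma linearCombination_comp_pi_of_dual_basis (h : ∀ m, ∑ i, f i m • y i = m) :
    Fintype.linearCombination R y ∘ₗ LinearMap.pi f = LinearMap.id :=
  LinearMap.ext fun m => (Fintype.linearCombination_apply R y _).trans (h m)

lemma projective_of_dual_basis (h : ∀ m, ∑ i, f i m • y i = m) : Module.Projective R M :=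
  .of_split _ _ (linearCombination_comp_pi_of_dual_basis h)

lemma finite_of_dual_basis (h : ∀ m, ∑ i, f i m • y i = m) : Module.Finite R M :=
  .of_surjective (Fintype.linearCombination R y) fun m =>
    ⟨LinearMap.pi f m, LinearMap.congr_fun (linearCombination_comp_pi_of_dual_basis h) m⟩

end DualBasis

section Galois

variable {k : Type u} {H : Type w} {A : Type v} [Field k] [Ring H] [Algebra k H]
  [Ring A] [Algebra k A]

lemma one_tmul_mul_eq_lTensor_targetMapOp [WeakBialgebra k H] {t : H}
    (ht : ∀ h, t * h = t * sourceMap k H h) (x : A ⊗[k] H) :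
    ((1 : A) ⊗ₜ[k] t) * x = ((1 : A) ⊗ₜ[k] t) * (targetMapOp k H).lTensor A x := by
  induction x with
  | zero => simp
  | tmul a h => simp [ht h, ht (targetMapOp k H h), sourceMap_targetMapOp]
  | add x y hx hy => rw [map_add, mul_add, mul_add, hx, hy]

variable [WeakHopfAlgebra k H] [WeakComoduleAlgebra k H A]

lemma coe_galoisMap_tmul (a b : A) :
    (galoisMap k H A (balancedTmul _ a b) : A ⊗[k] H) = (a ⊗ₜ[k] (1 : H)) * rho k H A b := rfl

lemma coe_galoisMap_smul (a : A) (z : BalancedTensor (coinvariants k H A) A) :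
    (galoisMap k H A (a • z) : A ⊗[k] H) = (a ⊗ₜ[k] (1 : H)) * galoisMap k H A z := by
  induction z using balancedTensor_induction with
  | zero => simp
  | tmul x y => simp [smul_balancedTmul, coe_galoisMap_tmul, ← mul_assoc]
  | add z z' hz hz' => simp [mul_add, hz, hz']

lemma coe_galoisMap_balancedMapₗ (a : A) (z : BalancedTensor (coinvariants k H A) A) :
    (galoisMap k H A (balancedMapₗ _ ((LinearMap.toSpanSingleton A A a).restrictScalars _) z) :
      A ⊗[k] H) = galoisMap k H A z * rho k H A a := by
  induction z using balancedTensor_induction with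
  | zero => simp
  | tmul x y => simp [balancedMapₗ_tmul, coe_galoisMap_tmul, rho_mul, mul_assoc]
  | add z z' hz hz' => simp [add_mul, hz, hz']

lemma sliceRight_counit_galoisMap (z : BalancedTensor (coinvariants k H A) A) :
    sliceRight counit (galoisMap k H A z : A ⊗[k] H) =
      balancedLift _ (LinearMap.id : A →ₗ[coinvariants k H A] A) z := by
  induction z using balancedTensor_induction with
  | zero => simp
  | tmul x y =>
    rw [coe_galoisMap_tmul, sliceRight_tmul_one_mul]
    exact congrArg (x * ·) (dualAction_counit (k := k) (H := H) y)
  | add z z' hz hz' => simp [hz, hz']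

lemma IsWeakGalois.exists_isSeparabilityElement [IsSemisimpleRing H] (hgal : IsWeakGalois k H A) :
    ∃ e : BalancedTensor (coinvariants k H A) A, IsSeparabilityElement e := by
  obtain ⟨t, ht, ht_one⟩ := exists_normalized_integral k H
  obtain ⟨e, he⟩ := hgal.2 ⟨((1 : A) ⊗ₜ[k] t) * rho k H A 1, _, rfl⟩
  replace he := congrArg Subtype.val he
  refine ⟨e, ?_, fun a => hgal.1 (Subtype.ext ?_)⟩
  · have counit_t_mul : counit ∘ₗ LinearMap.mulLeft k t = counit (R := k) := by
      ext h
      simp [← counit_sourceMap_mul t h, ht_one]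
    rw [← sliceRight_counit_galoisMap, he, sliceRight_one_tmul_mul, counit_t_mul]
    exact dualAction_counit (k := k) (H := H) (1 : A)
  · rw [coe_galoisMap_smul, coe_galoisMap_balancedMapₗ, he]
    calc (a ⊗ₜ[k] (1 : H)) * (((1 : A) ⊗ₜ[k] t) * rho k H A 1)
        = ((1 : A) ⊗ₜ[k] t) * ((a ⊗ₜ[k] (1 : H)) * rho k H A 1) := by
          simp only [← mul_assoc, Algebra.TensorProduct.tmul_mul_tmul, mul_one, one_mul]
      _ = ((1 : A) ⊗ₜ[k] t) * rho k H A a := by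
          rw [← lTensor_targetMapOp_rho, ← one_tmul_mul_eq_lTensor_targetMapOp ht]
      _ = ((1 : A) ⊗ₜ[k] t) * rho k H A 1 * rho k H A a := by
          rw [mul_assoc, ← rho_mul, one_mul]

lemma IsWeakGalois.exists_sum (hgal : IsWeakGalois k H A) (x : A ⊗[k] H) :
    ∃ s : Finset (A × A), ∑ p ∈ s, (p.1 ⊗ₜ[k] (1 : H)) * rho k H A p.2 = x * rho k H A 1 := by
  obtain ⟨z, hz⟩ := hgal.2 ⟨x * rho k H A 1, x, rfl⟩
  obtain ⟨s, rfl⟩ := exists_eq_sum_balancedTmul _ z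
  exact ⟨s, by simpa [coe_galoisMap_tmul] using congrArg Subtype.val hz⟩

variable (k H A) in
/-- The map `x ⊗ h ↦ x₀ ⊗ x₁S(h)`, which exchanges the two forms `xy₀ ⊗ y₁` and `x₀y ⊗ x₁` of
the Galois map. -/
def rhoAntipode : A ⊗[k] H →ₗ[k] A ⊗[k] H :=
  TensorProduct.lift ((LinearMap.mul k (A ⊗[k] H)).compl₁₂ (rho k H A)
    (TensorProduct.mk k A H 1 ∘ₗ antipode k H))

@[simp] lemma rhoAntipode_tmul (x : A) (h : H) :
    rhoAntipode k H A (x ⊗ₜ h) = rho k H A x * ((1 : A) ⊗ₜ[k] antipode k H h) := rfl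

lemma rhoAntipode_tmul_one_mul (a : A) (x : A ⊗[k] H) :
    rhoAntipode k H A ((a ⊗ₜ[k] (1 : H)) * x) = rho k H A a * rhoAntipode k H A x := by
  induction x with
  | zero => simp
  | tmul x h => simp [rho_mul, mul_assoc]
  | add x y hx hy => simp only [map_add, mul_add, hx, hy]

lemma rhoAntipode_one_tmul_mul (g : H) (x : A ⊗[k] H) :
    rhoAntipode k H A (((1 : A) ⊗ₜ[k] g) * x) =
      rhoAntipode k H A x * ((1 : A) ⊗ₜ[k] antipode k H g) := by
  induction x with
  | zero => simp
  | tmul x h => simp [antipode_mul, mul_assoc]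
  | add x y hx hy => simp only [map_add, mul_add, add_mul, hx, hy]

lemma rhoAntipode_eq_lTensor_assoc (x : A ⊗[k] H) : rhoAntipode k H A x =
    (LinearMap.mul' k H ∘ₗ TensorProduct.map LinearMap.id (antipode k H)).lTensor A
      (TensorProduct.assoc k A H H ((rho k H A).rTensor H x)) := by
  induction x with
  | zero => simp
  | tmul x h =>
    rw [rhoAntipode_tmul, LinearMap.rTensor_tmul]
    induction rho k H A x with
    | zero => simp
    | tmul a g => simp
    | add x y hx hy => simp only [map_add, add_mul, add_tmul, hx, hy]
  | add x y hx hy => simp only [map_add, hx, hy]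

lemma rhoAntipode_rho (a : A) :
    rhoAntipode k H A (rho k H A a) = rho k H A 1 * (a ⊗ₜ[k] (1 : H)) := by
  have hconv : LinearMap.mul' k H ∘ₗ TensorProduct.map LinearMap.id (antipode k H) ∘ₗ comul =
      targetMap k H := WeakHopfAlgebra.conv_id_antipode
  rw [rhoAntipode_eq_lTensor_assoc, WeakComoduleAlgebra.coassoc, ← LinearMap.lTensor_comp_apply,
    LinearMap.comp_assoc, hconv, lTensor_targetMap_rho]

lemma sum_dualAction_mul {g : H} {s : Finset (A × A)}
    (hs : ∑ p ∈ s, (p.1 ⊗ₜ[k] (1 : H)) * rho k H A p.2 = ((1 : A) ⊗ₜ[k] g) * rho k H A 1)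
    (χ : H →ₗ[k] k) (a : A) : ∑ p ∈ s, dualAction χ (a * p.1) * p.2 =
      dualAction (χ ∘ₗ LinearMap.mulRight k (antipode k H g)) a := by
  have hrho : ∑ p ∈ s, rho k H A (a * p.1) * (p.2 ⊗ₜ[k] (1 : H)) =
      rho k H A a * ((1 : A) ⊗ₜ[k] antipode k H g) := by
    have key := congrArg (fun x => rho k H A a * rhoAntipode k H A x) hs
    simpa only [map_sum, rhoAntipode_tmul_one_mul, rhoAntipode_one_tmul_mul, rhoAntipode_rho,
      Finset.mul_sum, ← Algebra.TensorProduct.one_def, ← mul_assoc, ← rho_mul, mul_one] using key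
  have key := congrArg (sliceRight χ) hrho
  simp only [map_sum, sliceRight_mul_tmul_one, sliceRight_mul_one_tmul] at key
  exact key

-- If `β(∑ xᵢ ⊗ yᵢ) = (1 ⊗ g)ρ(1)` for `g` in a basis of `H`, then the functionals
-- `a ↦ λ((axᵢ)₁)(axᵢ)₀`, for suitable integrals `λ`, and the elements `yᵢ` form a dual basis.
lemma IsWeakGalois.exists_dual_basis [FiniteDimensional k H] (hgal : IsWeakGalois k H A) :
    ∃ (ι : Type v) (_ : Fintype ι) (f : ι → A →ₗ[coinvariants k H A] coinvariants k H A)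
      (y : ι → A), ∀ a, ∑ i, f i a • y i = a := by
  let e := Module.finBasis k H
  choose s hs using fun i => hgal.exists_sum ((1 : A) ⊗ₜ[k] e i)
  let trace (i) := (isLeftIntegral_traceIntegral e (e.coord i)).traceMap A
  refine ⟨Σ i, s i, inferInstance,
    fun p => trace p.1 ∘ₗ (LinearMap.toSpanSingleton A A p.2.1.1).restrictScalars _,
    fun p => p.2.1.2, fun a => ?_⟩
  have hcounit : ∑ i, traceIntegral e (e.coord i) ∘ₗ LinearMap.mulRight k (antipode k H (e i)) =
      counit := by
    ext h
    simp [← sum_traceIntegral_coord e h]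
  calc ∑ p : Σ i, s i, (trace p.1 (a * p.2.1.1)) • p.2.1.2
      = ∑ i, ∑ p ∈ s i, dualAction (traceIntegral e (e.coord i)) (a * p.1) * p.2 := by
        rw [Fintype.sum_sigma]
        exact Finset.sum_congr rfl fun i _ => Finset.sum_coe_sort (s i) fun p =>
          dualAction (traceIntegral e (e.coord i)) (a * p.1) * p.2
    _ = ∑ i, dualAction (traceIntegral e (e.coord i) ∘ₗ
          LinearMap.mulRight k (antipode k H (e i))) a :=
        Finset.sum_congr rfl fun i _ => sum_dualAction_mul (hs i) _ a
    _ = dualAction (counit : H →ₗ[k] k) a := by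
        rw [← hcounit]
        exact (sliceRight_sum _ _).symm
    _ = a := dualAction_counit a

end Galois

open CategoryTheory Limits

/-! ### Projective dimension under exact functors -/

section ExactFunctor

universe v₁ v₂ u₁ u₂

variable {C : Type u₁} {D : Type u₂} [Category.{v₁} C] [Category.{v₂} D] [Abelian C] [Abelian D]
  [EnoughProjectives C] (F : C ⥤ D) [F.PreservesProjectiveObjects] [PreservesFiniteLimits F]
  [PreservesFiniteColimits F]

lemma hasProjectiveDimensionLT_obj (n : ℕ) (X : C) (hX : HasProjectiveDimensionLT X n) :
    HasProjectiveDimensionLT (F.obj X) n := by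
  have : F.PreservesZeroMorphisms := F.preservesZeroMorphisms_of_preserves_terminal_object
  match n with
  | 0 =>
    rw [hasProjectiveDimensionLT_zero_iff_isZero] at hX ⊢
    exact F.map_isZero hX
  | 1 =>
    rw [← projective_iff_hasProjectiveDimensionLT_one] at hX ⊢
    exact F.projective_obj_of_projective hX
  | n + 2 =>
    let S := ShortComplex.mk (kernel.ι (Projective.π X)) (Projective.π X) (kernel.condition _)
    have hS : S.ShortExact := { exact := ShortComplex.exact_kernel (Projective.π X) }
    have hP : Projective S.X₂ := Projective.projective_over X
    have hker := (hS.hasProjectiveDimensionLT_X₃_iff n hP).1 hX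
    exact ((hS.map_of_exact F).hasProjectiveDimensionLT_X₃_iff n
      (F.projective_obj_of_projective hP)).2 (hasProjectiveDimensionLT_obj (n + 1) S.X₁ hker)

lemma projectiveDimension_obj_le (X : C) :
    projectiveDimension (F.obj X) ≤ projectiveDimension X :=
  sInf_le_sInf fun _ hn i hi => hasProjectiveDimensionLT_obj F i X (hn i hi)

end ExactFunctor

section Restriction

lemma projective_trans (R : Type u) (S : Type w) {N : Type w₁} [Semiring R] [Semiring S]
    [Module R S] [AddCommMonoid N] [Module R N] [Module S N] [IsScalarTower R S S]
    [IsScalarTower R S N] [Module.Projective R S] [Module.Projective S N] :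
    Module.Projective R N := by
  obtain ⟨s, hs⟩ := Module.projective_def'.1 ‹Module.Projective S N›
  have : Module.Projective R (N →₀ S) := by
    classical exact Module.Projective.of_equiv (finsuppLequivDFinsupp R).symm
  exact Module.Projective.of_split (s.restrictScalars R)
    ((Finsupp.linearCombination S id).restrictScalars R)
    (LinearMap.ext fun x => LinearMap.congr_fun hs x)

variable {R : Type u} {S : Type w} [Ring R] [Ring S] (f : R →+* S)

lemma exact_restrictScalars : PreservesFiniteLimits (ModuleCat.restrictScalars.{v} f) ∧
    PreservesFiniteColimits (ModuleCat.restrictScalars.{v} f) := by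
  have map_exact (T : ShortComplex (ModuleCat.{v} S)) (hT : T.Exact) :
      (T.map (ModuleCat.restrictScalars.{v} f)).Exact := by
    rw [ShortComplex.ShortExact.moduleCat_exact_iff_function_exact] at hT ⊢
    exact hT
  exact ((ModuleCat.restrictScalars.{v} f).exact_tfae.out 1 3).1 map_exact

variable {k : Type u} {A : Type v} [Field k] [Ring A] [Algebra k A] (B : Subalgebra k A)

lemma projectiveDimension_restrict_le [Module.Projective B A] (N : ModuleCat.{v} A) :
    projectiveDimension (ModuleCat.of B N) ≤ projectiveDimension N := by
  let F := ModuleCat.restrictScalars.{v} (B.val : B →+* A)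
  have : F.PreservesProjectiveObjects :=
    ⟨fun {N} hN => by
      have : Module.Projective A N := (IsProjective.iff_projective (R := A) N).2 hN
      exact (IsProjective.iff_projective (R := B) N).1 (projective_trans B A)⟩
  obtain ⟨_, _⟩ := exact_restrictScalars.{v} (B.val : B →+* A)
  exact projectiveDimension_obj_le F N

/-- The induction functor `A ⊗_B -` from left `B`-modules to left `A`-modules. -/
def balancedFunctor : ModuleCat.{v} B ⥤ ModuleCat.{v} A where
  obj M := ModuleCat.of A (BalancedTensor B M)
  map f := ModuleCat.ofHom (balancedMapₗ B f.hom)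
  map_id _ := ModuleCat.hom_ext (balancedTensor_hom_ext B fun _ => rfl)
  map_comp f g := ModuleCat.hom_ext (balancedMapₗ_comp B g.hom f.hom)

instance : (balancedFunctor B).Additive where
  map_add {_ _ f g} := ModuleCat.hom_ext (balancedMapₗ_add B f.hom g.hom)

/-- Induction is left adjoint to restriction, with unit `m ↦ 1 ⊗ m`. -/
def balancedAdjunction :
    balancedFunctor B ⊣ ModuleCat.restrictScalars.{v} (B.val : B →+* A) :=
  Adjunction.mkOfHomEquiv
    { homEquiv _ N :=
        { toFun g := ModuleCat.ofHom
            (Y := (ModuleCat.restrictScalars.{v} (B.val : B →+* A)).obj N)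
            (g.hom.restrictScalars B ∘ₗ balancedUnit B)
          invFun f := ModuleCat.ofHom (balancedLift B f.hom)
          left_inv _ := ModuleCat.hom_ext (balancedTensor_hom_ext B fun _ => one_smul A _)
          right_inv f := ModuleCat.hom_ext (LinearMap.ext fun m => one_smul A (f.hom m)) }
      homEquiv_naturality_left_symm _ _ :=
        ModuleCat.hom_ext (balancedTensor_hom_ext B fun _ => rfl)
      homEquiv_naturality_right _ _ := rfl }

instance : (balancedFunctor B).PreservesProjectiveObjects :=
  have : PreservesFiniteColimits (ModuleCat.restrictScalars.{v} (B.val : B →+* A)) :=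
    (exact_restrictScalars _).2
  Functor.preservesProjectiveObjects_of_adjunction_of_preservesEpimorphisms (balancedAdjunction B)

end Restriction

section Flat

variable {k : Type u} {A : Type v} [Field k] [Ring A] [Algebra k A] {B : Subalgebra k A}

lemma IsRightFaithfullyFlat.exact_map_iff (hflat : IsRightFaithfullyFlat B)
    (S : ShortComplex (ModuleCat.{v} B)) : (S.map (balancedFunctor B)).Exact ↔ S.Exact := by
  rw [ShortComplex.ShortExact.moduleCat_exact_iff_function_exact,
    ShortComplex.ShortExact.moduleCat_exact_iff_function_exact]
  exact (hflat S.X₁ S.X₂ S.X₃ S.f.hom S.g.hom).symm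

lemma IsRightFaithfullyFlat.mono_map_iff (hflat : IsRightFaithfullyFlat B)
    {M N : ModuleCat.{v} B} (f : M ⟶ N) : Mono ((balancedFunctor B).map f) ↔ Mono f := by
  let S := ShortComplex.mk (0 : M ⟶ M) f zero_comp
  rw [← S.exact_iff_mono rfl, ← hflat.exact_map_iff,
    (S.map (balancedFunctor B)).exact_iff_mono ((balancedFunctor B).map_zero M M)]
  rfl

-- After applying `A ⊗_B -` the unit is split by the counit, so it was injective to begin with.
lemma IsRightFaithfullyFlat.mono_unit (hflat : IsRightFaithfullyFlat B) (M : ModuleCat.{v} B) :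
    Mono ((balancedAdjunction B).unit.app M) := by
  refine (hflat.mono_map_iff _).1 ?_
  exact mono_of_mono_fac ((balancedAdjunction B).left_triangle_components M)

lemma IsRightFaithfullyFlat.projectiveDimension_balancedTensor_le
    (hflat : IsRightFaithfullyFlat B) (M : ModuleCat.{v} B) :
    projectiveDimension (ModuleCat.of A (BalancedTensor B M)) ≤ projectiveDimension M := by
  obtain ⟨_, _⟩ := ((balancedFunctor B).exact_tfae.out 1 3).1 fun S => (hflat.exact_map_iff S).2
  exact projectiveDimension_obj_le (balancedFunctor B) M

/-- Separability makes every `A`-module `N` a direct summand of `A ⊗_B N`. -/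
def IsSeparabilityElement.retract {e : BalancedTensor B A} (he : IsSeparabilityElement e)
    (N : ModuleCat.{v} A) : Retract N (ModuleCat.of A (BalancedTensor B N)) where
  i := ModuleCat.ofHom he.toBalancedTensor
  r := ModuleCat.ofHom (balancedLift B (LinearMap.id : N →ₗ[B] N))
  retract := ModuleCat.hom_ext (LinearMap.ext he.balancedLift_toBalancedTensor)

lemma IsSeparabilityElement.projectiveDimension_le {e : BalancedTensor B A}
    (he : IsSeparabilityElement e) (hflat : IsRightFaithfullyFlat B) (N : ModuleCat.{v} A) :
    projectiveDimension N ≤ projectiveDimension (ModuleCat.of B N) :=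
  (he.retract N).projectiveDimension_le.trans
    (hflat.projectiveDimension_balancedTensor_le (ModuleCat.of B N))

end Flat

/-! ### Finitistic dimension -/

section FinDim

lemma projectiveDimension_le_finDim {R : Type v} [Ring R] (M : ModuleCat.{v} R)
    (hM : Module.Finite R M) (hpd : projectiveDimension M < ⊤) :
    projectiveDimension M ≤ finDim R :=
  le_iSup₂_of_le M hM (le_iSup_of_le hpd le_rfl)

open Order in
lemma not_isSuccLimit_of_lt_top {d : WithBot ℕ∞} (hd : d < ⊤) : ¬ IsSuccLimit d := by
  intro h
  induction d with
  | bot => exact h.not_isMin isMin_bot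
  | coe d =>
    induction d with
    | top => exact hd.ne rfl
    | coe n =>
      cases n with
      | zero => exact h.isSuccPrelimit _ (WithBot.bot_covBy_coe.2 isMin_bot)
      | succ n =>
        exact h.isSuccPrelimit _
          (WithBot.coe_covBy_coe.2 (WithTop.coe_covBy_coe.2 (covBy_add_one n)))

lemma exists_projectiveDimension_eq_finDim {R : Type v} [Ring R] (h : finDim R < ⊤) :
    ∃ M : ModuleCat.{v} R, Module.Finite R M ∧ projectiveDimension M = finDim R := by
  let T : Set (ModuleCat.{v} R) := {M | Module.Finite R M ∧ projectiveDimension M < ⊤}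
  have hT : finDim R = sSup (projectiveDimension '' T) := by
    simp only [finDim, sSup_image, T, Set.mem_ofPred_eq, iSup_and]
  have hbot : projectiveDimension (ModuleCat.of R PUnit.{v + 1}) = ⊥ :=
    (projectiveDimension_eq_bot_iff _).2 (ModuleCat.isZero_of_subsingleton _)
  have hne : (projectiveDimension '' T).Nonempty :=
    ⟨_, ModuleCat.of R PUnit, ⟨inferInstance, hbot ▸ bot_lt_top⟩, rfl⟩
  obtain ⟨M, hM, hpd⟩ := csSup_mem_of_not_isSuccLimit hne (OrderTop.bddAbove _)
    (hT ▸ not_isSuccLimit_of_lt_top h)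
  exact ⟨M, hM.1, hpd.trans hT.symm⟩

lemma projectiveDimension_X₁_lt_of_finDim_le {R : Type v} [Ring R]
    {S : ShortComplex (ModuleCat.{v} R)} (hS : S.ShortExact) [Module.Finite R S.X₂] {n : ℕ}
    (hR : finDim R ≤ n) (h₁ : projectiveDimension S.X₁ < ⊤) (h₂ : projectiveDimension S.X₂ < n) :
    projectiveDimension S.X₁ < n := by
  obtain ⟨m, hm⟩ := (projectiveDimension_ne_top_iff _).1 h₁.ne
  have h₂' := projectiveDimension_lt_iff.1 h₂
  have h₃ : projectiveDimension S.X₃ < ⊤ := by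
    have h₁' := hasProjectiveDimensionLT_of_ge S.X₁ (m + 1) (m + n + 1) (by lia)
    have h₂' := hasProjectiveDimensionLT_of_ge S.X₂ n (m + n + 2) (by lia)
    have := hS.hasProjectiveDimensionLT_X₃ (m + n + 1) h₁' h₂'
    exact lt_top_iff_ne_top.2 ((projectiveDimension_ne_top_iff _).2 ⟨m + n + 1, this⟩)
  have h₃fin : Module.Finite R S.X₃ :=
    Module.Finite.of_surjective S.g.hom ((ModuleCat.epi_iff_surjective S.g).1 hS.epi_g)
  have h₃le := (projectiveDimension_le_iff _ n).1
    ((projectiveDimension_le_finDim _ h₃fin h₃).trans hR)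
  exact projectiveDimension_lt_iff.2 (hS.hasProjectiveDimensionLT_X₁ n h₂' h₃le)

variable {k : Type u} {A : Type v} [Field k] [Ring A] [Algebra k A] {B : Subalgebra k A}
  [Module.Projective B A] [Module.Finite B A]

lemma IsSeparabilityElement.finDim_le {e : BalancedTensor B A} (he : IsSeparabilityElement e)
    (hflat : IsRightFaithfullyFlat B) : finDim A ≤ finDim B := by
  refine iSup₂_le fun N hN => iSup_le fun hpd => ?_
  exact (he.projectiveDimension_le hflat N).trans (projectiveDimension_le_finDim _
    (Module.Finite.trans (R := B) A N) ((projectiveDimension_restrict_le B N).trans_lt hpd))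

lemma IsRightFaithfullyFlat.finDim_le (hflat : IsRightFaithfullyFlat B) (hB : finDim B < ⊤) :
    finDim B ≤ finDim A := by
  by_contra! hlt
  obtain ⟨d, hd⟩ := WithBot.ne_bot_iff_exists.1 hlt.ne_bot
  obtain ⟨n, rfl⟩ := ENat.ne_top_iff_exists.1 fun htop : d = ⊤ =>
    hB.ne (hd.symm.trans (congrArg _ htop))
  obtain ⟨M, hM, hMn⟩ := exists_projectiveDimension_eq_finDim hB
  let N := ModuleCat.of A (BalancedTensor B M)
  have hNfin : Module.Finite A N := finite_balancedTensor B
  have hNB : Module.Finite B N := Module.Finite.trans (R := B) A N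
  have hN : projectiveDimension N < ⊤ :=
    (hflat.projectiveDimension_balancedTensor_le M).trans_lt (hMn ▸ hB)
  have hNn : projectiveDimension (ModuleCat.of B N) < n := by
    calc projectiveDimension (ModuleCat.of B N) ≤ projectiveDimension N :=
          projectiveDimension_restrict_le B N
      _ ≤ finDim A := projectiveDimension_le_finDim N hNfin hN
      _ < finDim B := hlt
      _ = n := hd.symm
  let S := ShortComplex.mk ((balancedAdjunction B).unit.app M) (cokernel.π _)
    (cokernel.condition _)
  have hS : S.ShortExact :=
    { exact := ShortComplex.exact_cokernel _
      mono_f := hflat.mono_unit M }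
  have : Module.Finite B S.X₂ := hNB
  have hMlt := projectiveDimension_X₁_lt_of_finDim_le hS hd.symm.le (hMn.trans_lt hB) hNn
  exact hMlt.ne (hMn.trans hd.symm)

end FinDim

end WeakHopf

end

theorem corollary2p4_general (k : Type u) [Field k] (H : Type w) [Ring H] [Algebra k H]
    [WeakHopf.WeakHopfAlgebra k H] [FiniteDimensional k H] [IsSemisimpleRing H]
    (A : Type v) [Ring A] [Algebra k A] [WeakHopf.WeakComoduleAlgebra k H A]
    (hflat : WeakHopf.IsRightFaithfullyFlat (WeakHopf.coinvariants k H A))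
    (hgal : WeakHopf.IsWeakGalois k H A)
    (hB : WeakHopf.finDim (WeakHopf.coinvariants k H A) < ⊤) :
    WeakHopf.finDim (WeakHopf.coinvariants k H A) = WeakHopf.finDim A := by
  obtain ⟨ι, _, f, y, hfy⟩ := hgal.exists_dual_basis
  have := WeakHopf.projective_of_dual_basis hfy
  have := WeakHopf.finite_of_dual_basis hfy
  obtain ⟨e, he⟩ := hgal.exists_isSeparabilityElement
  exact le_antisymm (hflat.finDim_le hB) (he.finDim_le hflat)

theorem corollary2p4 (k : Type u) [Field k] (H : Type w) [Ring H] [Algebra k H]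
    [WeakHopf.WeakHopfAlgebra k H] (hHfin : FiniteDimensional k H) (hHss : IsSemisimpleRing H)
    (A : Type v) [Ring A] [Algebra k A] [WeakHopf.WeakComoduleAlgebra k H A]
    (hBfin : FiniteDimensional k (WeakHopf.coinvariants k H A))
    (hflat : WeakHopf.IsRightFaithfullyFlat (WeakHopf.coinvariants k H A))
    (hgal : WeakHopf.IsWeakGalois k H A)
    (hconj : WeakHopf.FinitisticDimensionConjecture.{u, v} k) :
    WeakHopf.finDim (WeakHopf.coinvariants k H A) = WeakHopf.finDim A :=
  corollary2p4_general k H A hflat hgal (hconj _ hBfin)
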